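/- A finite hypergraph $\mathcal H$ consists of a finite vertex set $V(\mathcal H)$ and a set of subsets of it, its edges; it is an $r$-graph if all its edges have exactly $r$ elements. A hypergraph $\mathcal H$ is embeddable in $\mathcal G$ (or $\mathcal G$ contains $\mathcal H$) if there is an injective map $f:V(\mathcal H)\to V(\mathcal G)$ with $f(E)\in\mathcal G$ for all $E\in\mathcal H$. An $r$-tree is an $r$-graph whose edges can be ordered as $E_1,\dots,E_m$ so that for every $i>1$ there is $\alpha(i)<i$ with $E_i\cap\bigcup_{j<i}E_j\subseteq E_{\alpha(i)}$. A hypergraph is $2$-reducible if each of its edges contains at least two vertices of degree $1$, that is, vertices lying in exactly one edge. A cross-cut of $\mathcal H$ is a set of vertices containing exactly one vertex of each edge of $\mathcal H$; if $\mathcal H$ has a cross-cut, the cross-cut number $\sigma(\mathcal H)$ is the minimum size of one. The Turán number $\mathrm{ex}(n,\mathcal H)$ of an $r$-graph $\mathcal H$ is the largest number of edges of an $r$-graph on $n$ vertices that does not contain $\mathcal H$. **Theorem.** Let $r\ge 4$ and let $\mathcal H$ be an $r$-graph with at least one edge that is embeddable in a $2$-reducible $r$-tree. Then $\mathcal H$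 has a cross-cut. Let $\sigma=\sigma(\mathcal H)$ and $\beta=\dfrac{1}{(r-2)(\sigma+1)+1}$. There are constants $C_1,C_2$, depending only on $\mathcal H$ (and thus on $r$), such that for all $n\ge 1$ $$(\sigma-1)\binom{n}{r-1}-C_1n^{r-2}\ \le\ \mathrm{ex}(n,\mathcal H)\ \le\ (\sigma-1)\binom{n}{r-1}+C_2n^{r-1-\beta}.$$ If $\sigma=1$, then moreover there is a constant $C_3$, depending only on $\mathcal H$, such that $\mathrm{ex}(n,\mathcal H)\le C_3n^{r-2}$ for all $n\ge1$. -/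

import Mathlib

/-! Finite hypergraphs are given by a finite vertex type `V` and a finite set of edges
`H : Finset (Finset V)`; such an `H` is an `r`-graph when all its edges have exactly `r` elements
(`(H : Set (Finset V)).Sized r`). -/

namespace Hypertree

/-- `H` is embeddable in `G` (equivalently, `G` contains a copy of `H` as a subgraph): some
injective map of the vertices sends every edge of `H` to an edge of `G`. -/
def Embeds {V W : Type*} (H : Finset (Finset V)) (G : Finset (Finset W)) : Prop :=
  ∃ f : V ↪ W, ∀ A ∈ H, A.map f ∈ G

/-- `T` is a hypergraph tree: its edges can be listed (without repetition) as `E 0, ..., E (m - 1)`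
so that for every `i` other than the first there is some `j < i` such that
`E i ∩ ⋃ k < i, E k ⊆ E j`. -/
def IsTree {V : Type*} [DecidableEq V] (T : Finset (Finset V)) : Prop :=
  ∃ (m : ℕ) (E : Fin m → Finset V), Function.Injective E ∧ (∀ A, A ∈ T ↔ ∃ i, E i = A) ∧
    ∀ i : Fin m, 0 < (i : ℕ) → ∃ j < i, E i ∩ (Finset.Iio i).biUnion E ⊆ E j

/-- The degree of a vertex: the number of edges that contain it. -/
def degree {V : Type*} [DecidableEq V] (H : Finset (Finset V)) (v : V) : ℕ :=
  (H.filter (fun A => v ∈ A)).card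

/-- `H` is `k`-reducible: every edge contains at least `k` vertices of degree one. -/
def IsReducible {V : Type*} [DecidableEq V] (k : ℕ) (H : Finset (Finset V)) : Prop :=
  ∀ A ∈ H, k ≤ (A.filter (fun v => degree H v = 1)).card

/-- A cross-cut of `H`: a set of vertices that contains exactly one vertex of each edge. -/
def IsCrossCut {V : Type*} [DecidableEq V] (H : Finset (Finset V)) (S : Finset V) : Prop :=
  ∀ A ∈ H, (A ∩ S).card = 1

/-- The cross-cut number: the minimum size of a cross-cut (meaningful if a cross-cut exists). -/
noncomputable def crossCutNumber {V : Type*} [DecidableEq V] (H : Finset (Finset V)) : ℕ :=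
  sInf {k : ℕ | ∃ S : Finset V, IsCrossCut H S ∧ S.card = k}

/-- The Turán number `ex(n, H)` of an `r`-graph `H`: the largest number of edges of an `r`-graph
on `n` vertices that contains no copy of `H`. -/
noncomputable def turanNumber {V : Type*} (r n : ℕ) (H : Finset (Finset V)) : ℕ :=
  sSup {k : ℕ | ∃ F : Finset (Finset (Fin n)),
    (F : Set (Finset (Fin n))).Sized r ∧ ¬ Embeds H F ∧ F.card = k}

/-- The set in the definition of the Turán number is bounded, so its supremum is not a junk
value. -/
theorem bddAbove_turan {V : Type*} (r n : ℕ) (H : Finset (Finset V)) :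
    BddAbove {k : ℕ | ∃ F : Finset (Finset (Fin n)),
      (F : Set (Finset (Fin n))).Sized r ∧ ¬ Embeds H F ∧ F.card = k} := by
  refine ⟨Fintype.card (Finset (Fin n)), ?_⟩
  rintro k ⟨F, -, -, rfl⟩
  exact F.card_le_univ

end Hypertree

/-!
The proof follows the delta-system method. Call a set of vertices rich in a family if greedy
embeddings can always leave it towards fresh vertices. By Füredi's lemma (`exists_homogeneous`)
every `r`-graph contains a positive proportion of itself that is `r`-partite and homogeneous: each
set of colours (pattern) is either allowed, when the part of every edge in these colours is rich, or
forbidden, when no two edges intersect exactly in such a part. Allowed patterns are closed under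
intersection, which leaves three possibilities for a homogeneous family
(`Homogeneous.trichotomy`):

* some `r - 2` vertices of an edge determine it, and the family has at most `n ^ (r - 2)` edges;
* for some colours `a`, `b` all patterns missing both are allowed; then every `2`-reducible tree
  embeds, two vertices of degree one of each edge receiving the colours `a` and `b`
  (`Homogeneous.exists_embedding_of_pair`);
* for some colour `c` all patterns containing `c` are allowed; then every tree whose edges share a
  vertex embeds (`Homogeneous.exists_embedding_of_center`), which settles `σ = 1`.

In the third case, if the second does not occur as well, all patterns missing just `c` and two other
colours are forbidden. Then `r - 3` vertices of an edge, none of them of colour `c`, determine its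
vertex of colour `c`, so that the second shadows of the links of the vertices of colour `c` are
disjoint. By the Kruskal–Katona theorem a family with small degrees has therefore few edges
(`Homogeneous.card_le_of_degree_le`).

For the upper bound, let `L` be the set of vertices of degree at least `n ^ (r - 1 - γ)` in an
`H`-free `F`; it has `O(n ^ γ)` elements. The edges missing `L` are few by the above, and those with
at least two vertices in `L` are few since `L` is small. If `S` is a minimum cross-cut of `H`, the
traces of the edges of `H` on the complement of `S` lie in a tree of sets of size at most `r - 1`,
so any `σ` vertices of `L` have only `O(n ^ (r - 2))` common `(r - 1)`-sets in their links
(`exists_card_link_le`). Hence most `(r - 1)`-sets extend by at most `σ - 1` elements of `L`, which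
gives the main term (`card_filter_inter_eq_one_le`).

For the lower bound, the `r`-sets that meet a fixed `(σ - 1)`-set in exactly one vertex form an
`H`-free family.
-/

namespace Hypertree

/-! ### Homogeneous families -/

section Homogeneous

variable {α : Type*} {r : ℕ} {χ : α → Fin r}

/-- The vertices of `E` whose colour belongs to the pattern `P`. -/
def part (χ : α → Fin r) (P : Finset (Fin r)) (E : Finset α) : Finset α :=
  E.filter (fun v => χ v ∈ P)

lemma mem_part {P : Finset (Fin r)} {E : Finset α} {v : α} :
    v ∈ part χ P E ↔ v ∈ E ∧ χ v ∈ P := by simp [part]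

lemma part_subset (P : Finset (Fin r)) (E : Finset α) : part χ P E ⊆ E := Finset.filter_subset _ _

lemma exists_mem_color_eq {E : Finset α} (h : Set.InjOn χ (E : Set α)) (hc : E.card = r)
    (i : Fin r) : ∃ v ∈ E, χ v = i := by
  have : E.image χ = Finset.univ := by
    rw [← Finset.card_eq_iff_eq_univ, Finset.card_image_of_injOn h, hc, Fintype.card_fin]
  have h2 : i ∈ E.image χ := this ▸ Finset.mem_univ i
  simpa using h2

lemma part_mono {P Q : Finset (Fin r)} (h : P ⊆ Q) (E : Finset α) : part χ P E ⊆ part χ Q E := by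
  intro v hv
  rw [mem_part] at hv ⊢
  exact ⟨hv.1, h hv.2⟩

lemma part_eq_of_subset {E E' : Finset α} {P : Finset (Fin r)} (h : Set.InjOn χ (E : Set α))
    (hc : E.card = r) (h' : Set.InjOn χ (E' : Set α)) (hs : part χ P E ⊆ E') :
    part χ P E' = part χ P E := by
  ext v
  constructor
  · intro hv
    rw [mem_part] at hv
    obtain ⟨u, hu, huv⟩ := exists_mem_color_eq h hc (χ v)
    have hu2 : u ∈ part χ P E := mem_part.2 ⟨hu, huv ▸ hv.2⟩
    have := h' (hs hu2) hv.1 huv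
    exact this ▸ hu2
  · intro hv
    exact mem_part.2 ⟨hs hv, (mem_part.1 hv).2⟩

variable [DecidableEq α]

/-- `B` is `M`-rich in `F`: for every set `X` of at most `M` vertices some edge of `F` contains `B`
and avoids `X` outside of `B`. This is the only consequence of `B` being the kernel of a large
sunflower in `F` that greedy embeddings use. -/
def Rich (M : ℕ) (F : Finset (Finset α)) (B : Finset α) : Prop :=
  ∀ X : Finset α, X.card ≤ M → ∃ E ∈ F, B ⊆ E ∧ Disjoint (E \ B) X

/-- `F` is an `r`-partite `r`-graph with colour classes given by `χ`, and each set `P` of colours is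
of one of two kinds: if `P ∉ N`, then the `P`-part of every edge is `M`-rich; if `P ∈ N`, then no
two edges intersect exactly in their `P`-part. -/
structure Homogeneous (M : ℕ) (χ : α → Fin r) (N : Finset (Finset (Fin r)))
    (F : Finset (Finset α)) : Prop where
  rainbow : ∀ E ∈ F, Set.InjOn χ (E : Set α)
  card_eq : ∀ E ∈ F, E.card = r
  rich : ∀ P ∉ N, ∀ E ∈ F, Rich M F (part χ P E)
  avoid : ∀ P ∈ N, ∀ E ∈ F, ∀ E' ∈ F, E ∩ E' ≠ part χ P E

/-- Deleting, as long as possible, all edges through a part that is not rich leaves a family `G`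
in which all parts of the given patterns are rich. The edges deleted on account of a pattern `P`
come in groups with a common `P`-part and a bounded transversal; a most popular vertex of the
transversal selects a subfamily `D P` in which no two edges intersect exactly in their
`P`-part. -/
lemma exists_clean (M : ℕ) (N : Finset (Finset (Fin r))) (F : Finset (Finset α))
    (hrb : ∀ E ∈ F, Set.InjOn χ (E : Set α)) (hcard : ∀ E ∈ F, E.card = r) :
    ∃ G ⊆ F, ∃ D : Finset (Fin r) → Finset (Finset α), (∀ P, D P ⊆ F) ∧
      (∀ P ∉ N, ∀ E ∈ G, Rich M G (part χ P E)) ∧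
      (∀ P, ∀ E ∈ D P, ∀ E' ∈ D P, E ≠ E' → E ∩ E' ≠ part χ P E) ∧
      (∀ P, P = Finset.univ → D P = ∅) ∧
      F.card ≤ G.card + M * ∑ P ∈ Nᶜ, (D P).card := by
  classical
  induction hF : F.card using Nat.strong_induction_on generalizing F with
  | _ k ih =>
  by_cases hall : ∀ P ∉ N, ∀ E ∈ F, Rich M F (part χ P E)
  · exact ⟨F, le_rfl, fun _ => ∅, by simp, hall, by simp, by simp, by omega⟩
  push Not at hall
  obtain ⟨P, hP, E, hE, hrich⟩ := hall
  unfold Rich at hrich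
  push Not at hrich
  obtain ⟨X, hX, hXE⟩ := hrich
  set B := part χ P E with hB
  have hPu : P ≠ Finset.univ := by
    rintro rfl
    apply hXE E hE (part_subset _ _)
    simp [hB, part]
  set S := F.filter (fun E' => B ⊆ E') with hS
  have hES : E ∈ S := by simp [hS, hE, hB, part_subset]
  have hSF : S ⊆ F := Finset.filter_subset _ _
  have hlt : (F \ S).card < k := by
    rw [← hF]
    exact Finset.card_lt_card (Finset.sdiff_ssubset hSF ⟨E, hES⟩)
  obtain ⟨G, hGF, D, hDF, hGr, hDa, hDu, hc⟩ := ih _ hlt (F \ S)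
    (fun E hE => hrb E (Finset.sdiff_subset hE)) (fun E hE => hcard E (Finset.sdiff_subset hE)) rfl
  have hcov : S ⊆ X.biUnion (fun y => S.filter (fun E' => y ∈ E' \ B)) := by
    intro E' hE'
    have h1 := Finset.mem_filter.1 hE'
    have := hXE E' h1.1 h1.2
    rw [Finset.not_disjoint_iff] at this
    obtain ⟨y, hy, hyX⟩ := this
    simp only [Finset.mem_biUnion, Finset.mem_filter]
    exact ⟨y, hyX, hE', hy⟩
  have hXne : X.Nonempty := by
    obtain ⟨y, hy, -⟩ := Finset.mem_biUnion.1 (hcov hES)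
    exact ⟨y, hy⟩
  obtain ⟨y, hyX, hymax⟩ := Finset.exists_max_image X
    (fun y => (S.filter (fun E' => y ∈ E' \ B)).card) hXne
  set Sy := S.filter (fun E' => y ∈ E' \ B) with hSy
  have hScard : S.card ≤ M * Sy.card := by
    calc S.card ≤ _ := Finset.card_le_card hcov
      _ ≤ ∑ y ∈ X, (S.filter (fun E' => y ∈ E' \ B)).card := Finset.card_biUnion_le
      _ ≤ ∑ _y ∈ X, Sy.card := Finset.sum_le_sum hymax
      _ = X.card * Sy.card := by simp
      _ ≤ M * Sy.card := by gcongr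
  have hpart : ∀ E' ∈ S, part χ P E' = B := by
    intro E' hE'
    have h1 := Finset.mem_filter.1 hE'
    exact part_eq_of_subset (hrb E hE) (hcard E hE) (hrb E' h1.1) h1.2
  have hSyS : Sy ⊆ S := Finset.filter_subset _ _
  have hnotin : ∀ E' ∈ D P, ¬ B ⊆ E' := by
    intro E' hE' hBE
    have h1 := Finset.mem_sdiff.1 (hDF P hE')
    exact h1.2 (Finset.mem_filter.2 ⟨h1.1, hBE⟩)
  refine ⟨G, hGF.trans Finset.sdiff_subset,
    fun Q => if Q = P then D P ∪ Sy else D Q, ?_, hGr, ?_, ?_, ?_⟩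
  · intro Q
    by_cases hQ : Q = P
    · simp only [hQ, if_true]
      exact Finset.union_subset ((hDF P).trans Finset.sdiff_subset) (hSyS.trans hSF)
    · simp only [hQ, if_false]
      exact (hDF Q).trans Finset.sdiff_subset
  · intro Q
    by_cases hQ : Q = P
    · subst hQ
      simp only [if_true, Finset.mem_union]
      rintro E1 (h1 | h1) E2 (h2 | h2) hne heq
      · exact hDa Q E1 h1 E2 h2 hne heq
      · have h3 : part χ Q E1 ⊆ E2 := heq ▸ Finset.inter_subset_right
        have hE1F : E1 ∈ F := Finset.sdiff_subset (hDF Q h1)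
        have hE2F : E2 ∈ F := hSF (hSyS h2)
        have h4 := part_eq_of_subset (hrb E1 hE1F) (hcard E1 hE1F) (hrb E2 hE2F) h3
        rw [hpart E2 (hSyS h2)] at h4
        exact hnotin E1 h1 (h4 ▸ part_subset _ _)
      · rw [hpart E1 (hSyS h1)] at heq
        exact hnotin E2 h2 (heq ▸ Finset.inter_subset_right)
      · rw [hpart E1 (hSyS h1)] at heq
        have y1 := Finset.mem_sdiff.1 (Finset.mem_filter.1 h1).2
        have y2 := Finset.mem_sdiff.1 (Finset.mem_filter.1 h2).2
        exact y1.2 (heq ▸ Finset.mem_inter.2 ⟨y1.1, y2.1⟩)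
    · simp only [hQ, if_false]
      exact hDa Q
  · intro Q hQ
    have : Q ≠ P := by rintro rfl; exact hPu hQ
    simp only [this, if_false]
    exact hDu Q hQ
  · have hdisj : Disjoint (D P) Sy := by
      rw [Finset.disjoint_left]
      intro E' h1 h2
      exact (Finset.mem_sdiff.1 (hDF P h1)).2 (hSyS h2)
    have hPN : P ∈ Nᶜ := by simpa using hP
    have hsum : ∑ Q ∈ Nᶜ, (if Q = P then D P ∪ Sy else D Q).card
        = ∑ Q ∈ Nᶜ, (D Q).card + Sy.card := by
      rw [← Finset.add_sum_erase _ _ hPN, ← Finset.add_sum_erase _ (fun Q => (D Q).card) hPN]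
      rw [if_pos rfl, Finset.card_union_of_disjoint hdisj]
      rw [Finset.sum_congr rfl (g := fun Q => (D Q).card)]
      · ring
      · intro Q hQ
        rw [if_neg (Finset.ne_of_mem_erase hQ)]
    rw [hsum, mul_add, ← hF]
    have := Finset.card_sdiff_add_card_eq_card hSF
    omega

/-- Starting from a set `N` of patterns known to be forbidden, either cleaning keeps half of the
family, or a positive proportion of it makes one more pattern forbidden; being forbidden is
inherited by subfamilies, so this stops after at most `2 ^ r` rounds. -/
lemma exists_homogeneous_of_rainbow (M : ℕ) (k : ℕ) : ∀ (N : Finset (Finset (Fin r)))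
    (F : Finset (Finset α)), Nᶜ.card ≤ k →
    (∀ E ∈ F, Set.InjOn χ (E : Set α)) → (∀ E ∈ F, E.card = r) →
    (∀ P ∈ N, ∀ E ∈ F, ∀ E' ∈ F, E ∩ E' ≠ part χ P E) →
    ∃ (N' : Finset (Finset (Fin r))) (G : Finset (Finset α)), G ⊆ F ∧ Homogeneous M χ N' G ∧
      F.card ≤ (2 * M * 2 ^ 2 ^ r + 2) ^ (k + 1) * G.card := by
  classical
  induction k with
  | zero =>
    intro N F hk hrb hcard hav
    refine ⟨N, F, le_rfl, ⟨hrb, hcard, ?_, hav⟩, Nat.le_mul_of_pos_left _ (by positivity)⟩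
    intro P hP
    have : P ∈ Nᶜ := by simpa using hP
    rw [Finset.card_eq_zero.1 (Nat.le_zero.1 hk)] at this
    simp at this
  | succ k ih =>
    intro N F hk hrb hcard hav
    set c := 2 * M * 2 ^ 2 ^ r + 2 with hcdef
    obtain ⟨G, hGF, D, hDF, hGr, hDa, hDu, hc⟩ := exists_clean M N F hrb hcard
    by_cases hG : F.card ≤ 2 * G.card
    · refine ⟨N, G, hGF, ⟨fun E hE => hrb E (hGF hE), fun E hE => hcard E (hGF hE), hGr,
        fun P hP E hE E' hE' => hav P hP E (hGF hE) E' (hGF hE')⟩, hG.trans ?_⟩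
      gcongr
      calc 2 ≤ c := by omega
        _ = c ^ 1 := by simp
        _ ≤ c ^ (k + 1 + 1) := Nat.pow_le_pow_right (by omega) (by omega)
    · have hex : ∃ P ∈ Nᶜ, F.card ≤ c * (D P).card := by
        by_contra hcon
        push Not at hcon
        have h1 : ∑ P ∈ Nᶜ, (c * (D P).card) ≤ ∑ _P ∈ Nᶜ, F.card :=
          Finset.sum_le_sum fun P hP => (hcon P hP).le
        rw [← Finset.mul_sum, Finset.sum_const, smul_eq_mul] at h1
        have h2 : Nᶜ.card ≤ 2 ^ 2 ^ r := by
          calc Nᶜ.card ≤ Fintype.card (Finset (Fin r)) := Finset.card_le_univ _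
            _ = 2 ^ r := by simp
            _ ≤ 2 ^ 2 ^ r := Nat.pow_le_pow_right (by norm_num) (Nat.lt_two_pow_self).le
        set s := ∑ P ∈ Nᶜ, (D P).card
        have h3 : 2 ^ 2 ^ r * (2 * M * s) + 2 * s ≤ 2 ^ 2 ^ r * F.card := by
          calc _ = c * s := by rw [hcdef]; ring
            _ ≤ _ := h1
            _ ≤ _ := by gcongr
        have h4 : F.card < 2 * M * s := by
          have : 2 * M * s = 2 * (M * s) := by ring
          omega
        have h5 : 2 ^ 2 ^ r * F.card < 2 ^ 2 ^ r * (2 * M * s) :=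
          Nat.mul_lt_mul_of_pos_left h4 (by positivity)
        omega
      obtain ⟨P, hP, hPc⟩ := hex
      have hPN : P ∉ N := by simpa using hP
      have hDav : ∀ E ∈ D P, ∀ E' ∈ D P, E ∩ E' ≠ part χ P E := by
        intro E hE E' hE' heq
        by_cases hne : E = E'
        · subst hne
          rw [Finset.inter_self] at heq
          have hPu : P = Finset.univ := by
            ext i
            obtain ⟨v, hv, rfl⟩ := exists_mem_color_eq (hrb E (hDF P hE)) (hcard E (hDF P hE)) i
            rw [heq] at hv
            simpa using (mem_part.1 hv).2
          rw [hDu P hPu] at hE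
          simp at hE
        · exact hDa P E hE E' hE' hne heq
      obtain ⟨N', G', hG', hhom, hle⟩ := ih (insert P N) (D P) (by
          rw [Finset.compl_insert, Finset.card_erase_of_mem hP]; omega)
        (fun E hE => hrb E (hDF P hE)) (fun E hE => hcard E (hDF P hE)) (by
          intro Q hQ E hE E' hE'
          rcases Finset.mem_insert.1 hQ with rfl | hQ
          · exact hDav E hE E' hE'
          · exact hav Q hQ E (hDF P hE) E' (hDF P hE'))
      refine ⟨N', G', hG'.trans (hDF P), hhom, hPc.trans ?_⟩
      calc c * (D P).card ≤ c * (c ^ (k + 1) * G'.card) := by gcongr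
        _ = _ := by ring

/-- A uniformly random colouring makes a given `r`-set rainbow with probability at least
`r ^ (-r)`. -/
lemma exists_rainbow_subfamily [Fintype α] (hr : 0 < r) (F : Finset (Finset α))
    (hcard : ∀ E ∈ F, E.card = r) :
    ∃ χ : α → Fin r, ∃ G ⊆ F, (∀ E ∈ G, Set.InjOn χ (E : Set α)) ∧ F.card ≤ r ^ r * G.card := by
  classical
  have : Nonempty (Fin r) := ⟨⟨0, hr⟩⟩
  set G : (α → Fin r) → Finset (Finset α) :=
    fun χ => F.filter (fun E => Set.InjOn χ (E : Set α)) with hG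
  have hE : ∀ E ∈ F, Fintype.card (α → Fin r) ≤
      r ^ r * (Finset.univ.filter (fun χ : α → Fin r => Set.InjOn χ (E : Set α))).card := by
    intro E hE
    let e : E ≃ Fin r := E.equivFinOfCardEq (hcard E hE)
    -- Recolouring `E` by a fixed bijection is at most `r ^ r`-to-one.
    let φ : (α → Fin r) → (α → Fin r) := fun χ v => if h : v ∈ E then e ⟨v, h⟩ else χ v
    have h1 : ∀ χ ∈ (Finset.univ : Finset (α → Fin r)), φ χ ∈
        Finset.univ.filter (fun χ : α → Fin r => Set.InjOn χ (E : Set α)) := by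
      intro χ _
      simp only [Finset.mem_filter, Finset.mem_univ, true_and]
      intro u hu v hv huv
      have hu' : u ∈ E := hu
      have hv' : v ∈ E := hv
      simp only [φ, hu', hv', dif_pos] at huv
      simpa using huv
    rw [← Finset.card_univ]
    refine Finset.card_le_mul_card_image_of_maps_to h1 _ ?_
    intro ψ _
    have h2 : (Finset.univ.filter (fun χ => φ χ = ψ)).card ≤ Fintype.card (E → Fin r) := by
      rw [← Finset.card_univ]
      refine Finset.card_le_card_of_injOn (fun χ v => χ v) (by simp) ?_
      intro χ₁ h₁ χ₂ h₂ heq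
      simp only [Finset.coe_filter, Finset.mem_univ, true_and, Set.mem_ofPred_eq] at h₁ h₂
      funext v
      by_cases hv : v ∈ E
      · exact congrFun heq ⟨v, hv⟩
      · have := congrFun (h₁.trans h₂.symm) v
        simpa [φ, hv] using this
    simpa [hcard E hE] using h2
  by_contra hcon
  push Not at hcon
  have hlt : ∀ χ : α → Fin r, r ^ r * (G χ).card < F.card := fun χ =>
    hcon χ (G χ) (Finset.filter_subset _ _) (fun E hE => (Finset.mem_filter.1 hE).2)
  have h1 : ∑ χ : α → Fin r, (G χ).card = ∑ E ∈ F,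
      (Finset.univ.filter (fun χ : α → Fin r => Set.InjOn χ (E : Set α))).card := by
    simp only [hG, Finset.card_filter]
    exact Finset.sum_comm
  have h2 : ∑ χ : α → Fin r, r ^ r * (G χ).card < ∑ _χ : α → Fin r, F.card :=
    Finset.sum_lt_sum_of_nonempty Finset.univ_nonempty fun χ _ => hlt χ
  rw [← Finset.mul_sum, h1, Finset.mul_sum] at h2
  have h3 := Finset.sum_le_sum hE
  simp only [Finset.sum_const, smul_eq_mul, Finset.card_univ] at h2 h3
  rw [mul_comm] at h3
  omega

/-- Füredi's delta-system lemma: every `r`-graph contains a homogeneous subfamily that is a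
positive proportion of it. -/
lemma exists_homogeneous (r M : ℕ) (hr : 0 < r) : ∃ c : ℕ, ∀ (n : ℕ) (F : Finset (Finset (Fin n))),
    (F : Set (Finset (Fin n))).Sized r →
    ∃ (χ : Fin n → Fin r) (N : Finset (Finset (Fin r))) (G : Finset (Finset (Fin n))),
      G ⊆ F ∧ Homogeneous M χ N G ∧ F.card ≤ c * G.card := by
  refine ⟨r ^ r * (2 * M * 2 ^ 2 ^ r + 2) ^
    ((∅ : Finset (Finset (Fin r)))ᶜ.card + 1), fun n F hF => ?_⟩
  obtain ⟨χ, G, hGF, hrb, hGc⟩ := exists_rainbow_subfamily hr F (fun E hE => hF hE)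
  obtain ⟨N, G', hG', hhom, hc⟩ := exists_homogeneous_of_rainbow (χ := χ) M _ ∅ G le_rfl hrb
    (fun E hE => hF (hGF hE)) (by simp)
  refine ⟨χ, N, G', hG'.trans hGF, hhom, hGc.trans ?_⟩
  rw [mul_assoc]
  gcongr

end Homogeneous

/-! ### Forbidden and allowed patterns -/

section Patterns

variable {α : Type*} [DecidableEq α] {r M : ℕ} {χ : α → Fin r} {N : Finset (Finset (Fin r))}
  {F : Finset (Finset α)}

lemma part_inter (P Q : Finset (Fin r)) (E : Finset α) :
    part χ (P ∩ Q) E = part χ P E ∩ part χ Q E := by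
  ext v; simp only [mem_part, Finset.mem_inter]; tauto

namespace Homogeneous

lemma univ_notMem (h : Homogeneous M χ N F) (hne : F.Nonempty) : Finset.univ ∉ N := by
  intro hN
  obtain ⟨E, hE⟩ := hne
  exact h.avoid _ hN E hE E hE (by simp [part])

/-- Two edges through the `P`-part and the `Q`-part of an edge that are as disjoint as possible
intersect exactly in the `P ∩ Q`-part. -/
lemma inter_notMem (h : Homogeneous M χ N F) (hne : F.Nonempty) (hM : 2 * r ≤ M)
    {P Q : Finset (Fin r)} (hP : P ∉ N) (hQ : Q ∉ N) : P ∩ Q ∉ N := by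
  intro hN
  obtain ⟨E, hE⟩ := hne
  obtain ⟨E₁, hE₁, hs₁, hd₁⟩ := h.rich P hP E hE E (by rw [h.card_eq E hE]; omega)
  obtain ⟨E₂, hE₂, hs₂, hd₂⟩ := h.rich Q hQ E hE (E ∪ E₁) (by
    have := Finset.card_union_le E E₁
    rw [h.card_eq E hE, h.card_eq E₁ hE₁] at this
    omega)
  refine h.avoid _ hN E₁ hE₁ E₂ hE₂ ?_
  rw [part_eq_of_subset (h.rainbow E hE) (h.card_eq E hE) (h.rainbow E₁ hE₁)
    ((part_mono Finset.inter_subset_left E).trans hs₁), part_inter]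
  rw [Finset.disjoint_left] at hd₁ hd₂
  ext v
  simp only [Finset.mem_inter]
  constructor
  · rintro ⟨h1, h2⟩
    have hvQ : v ∈ part χ Q E := by
      by_contra hv
      exact hd₂ (Finset.mem_sdiff.2 ⟨h2, hv⟩) (Finset.mem_union_right _ h1)
    refine ⟨?_, hvQ⟩
    by_contra hv
    exact hd₁ (Finset.mem_sdiff.2 ⟨h1, hv⟩) (part_subset _ _ hvQ)
  · rintro ⟨h1, h2⟩
    exact ⟨hs₁ h1, hs₂ h2⟩

lemma card_part (h : Homogeneous M χ N F) {E : Finset α} (hE : E ∈ F) (P : Finset (Fin r)) :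
    (part χ P E).card = P.card := by
  have : (part χ P E).image χ = P := by
    ext i
    simp only [Finset.mem_image, mem_part]
    constructor
    · rintro ⟨v, hv, rfl⟩; exact hv.2
    · intro hi
      obtain ⟨v, hv, rfl⟩ := exists_mem_color_eq (h.rainbow E hE) (h.card_eq E hE) i
      exact ⟨v, ⟨hv, hi⟩, rfl⟩
  rw [← this, Finset.card_image_of_injOn]
  · rw [this]
  · exact (h.rainbow E hE).mono (part_subset _ _)

/-- If every proper superset of `P` is forbidden, then the `P`-part of an edge determines the
edge. -/
lemma card_le_of_forall_superset_mem {n : ℕ} {χ : Fin n → Fin r} {F : Finset (Finset (Fin n))}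
    (h : Homogeneous M χ N F) {P : Finset (Fin r)}
    (hP : ∀ Q, P ⊆ Q → Q ≠ Finset.univ → Q ∈ N) : F.card ≤ n.choose P.card := by
  have h1 : (Finset.powersetCard P.card (Finset.univ : Finset (Fin n))).card = n.choose P.card := by
    simp
  rw [← h1]
  refine Finset.card_le_card_of_injOn (part χ P) ?_ ?_
  · intro E hE
    simp [h.card_part hE P]
  · intro E hE E' hE' heq
    by_contra hne
    have hE : E ∈ F := hE
    have hE' : E' ∈ F := hE'
    have hpart : part χ ((E ∩ E').image χ) E = E ∩ E' := by
      ext v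
      simp only [mem_part, Finset.mem_image]
      constructor
      · rintro ⟨hv, u, hu, huv⟩
        have := h.rainbow E hE (Finset.mem_inter.1 hu).1 hv huv
        exact this ▸ hu
      · intro hv
        exact ⟨(Finset.mem_inter.1 hv).1, v, hv, rfl⟩
    refine h.avoid ((E ∩ E').image χ) (hP _ ?_ ?_) E hE E' hE' hpart.symm
    · intro i hi
      obtain ⟨v, hv, rfl⟩ := exists_mem_color_eq (h.rainbow E hE) (h.card_eq E hE) i
      have h2 : v ∈ part χ P E := mem_part.2 ⟨hv, hi⟩
      have h3 : v ∈ part χ P E' := by rw [← heq]; exact h2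
      exact Finset.mem_image_of_mem _ (Finset.mem_inter.2 ⟨hv, part_subset _ _ h3⟩)
    · intro hu
      rw [hu] at hpart
      have h2 : E ⊆ E' := by
        have : part χ Finset.univ E = E := by simp [part]
        rw [this] at hpart
        rw [hpart]
        exact Finset.inter_subset_right
      exact hne (Finset.eq_of_subset_of_card_le h2 (by rw [h.card_eq E hE, h.card_eq E' hE']))

/-- If `P` is forbidden but `P ∪ {c}` is allowed, then the `P`-part of an edge determines its
vertex of colour `c`. -/
lemma mem_of_part_subset (h : Homogeneous M χ N F) (hM : r ≤ M) {P : Finset (Fin r)} {c : Fin r}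
    (hP : P ∈ N) (hcP : insert c P ∉ N) {E E' : Finset α} (hE : E ∈ F) (hE' : E' ∈ F)
    (hs : part χ P E ⊆ E') {x : α} (hx : x ∈ E) (hxc : χ x = c) : x ∈ E' := by
  by_contra hxE'
  obtain ⟨E₁, hE₁, hs₁, hd₁⟩ := h.rich _ hcP E hE E' (by rw [h.card_eq E' hE']; omega)
  have hs₂ : part χ P E ⊆ E₁ := (part_mono (Finset.subset_insert _ _) E).trans hs₁
  refine h.avoid P hP E₁ hE₁ E' hE' ?_
  rw [part_eq_of_subset (h.rainbow E hE) (h.card_eq E hE) (h.rainbow E₁ hE₁) hs₂]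
  rw [Finset.disjoint_left] at hd₁
  ext v
  constructor
  · intro hv
    rw [Finset.mem_inter] at hv
    have h1 : v ∈ part χ (insert c P) E := by
      by_contra hv'
      exact hd₁ (Finset.mem_sdiff.2 ⟨hv.1, hv'⟩) hv.2
    rw [mem_part, Finset.mem_insert] at h1
    rcases h1 with ⟨hvE, hvc | hvP⟩
    · have := h.rainbow E hE hvE hx (hvc.trans hxc.symm)
      exact absurd (this ▸ hv.2) hxE'
    · exact mem_part.2 ⟨hvE, hvP⟩
  · intro hv
    exact Finset.mem_inter.2 ⟨hs₂ hv, hs hv⟩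

end Homogeneous

/-- Removing elements from an allowed pattern one at a time, by intersecting with allowed
patterns. -/
lemma sdiff_notMem (hinter : ∀ P ∉ N, ∀ Q ∉ N, P ∩ Q ∉ N) {P₀ : Finset (Fin r)} (h₀ : P₀ ∉ N)
    (S : Finset (Fin r)) (hS : ∀ i ∈ S, ∃ Q ∉ N, P₀.erase i ⊆ Q ∧ i ∉ Q) : P₀ \ S ∉ N := by
  induction S using Finset.induction_on with
  | empty => simpa using h₀
  | insert i S hi ih =>
    obtain ⟨Q, hQ, hsub, hiQ⟩ := hS i (Finset.mem_insert_self _ _)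
    have h1 := hinter _ (ih fun j hj => hS j (Finset.mem_insert_of_mem hj)) Q hQ
    convert h1 using 2
    ext v
    simp only [Finset.mem_sdiff, Finset.mem_insert, Finset.mem_inter, not_or]
    constructor
    · rintro ⟨hv, hvi, hvS⟩
      exact ⟨⟨hv, hvS⟩, hsub (Finset.mem_erase.2 ⟨hvi, hv⟩)⟩
    · rintro ⟨⟨hv, hvS⟩, hvQ⟩
      refine ⟨hv, ?_, hvS⟩
      rintro rfl
      exact hiQ hvQ

/-- A family of allowed patterns that is closed under intersection and covers all sets of `r - 2`
colours by proper subsets contains either all patterns missing two fixed colours, or all patterns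
containing a fixed colour. The former holds if `{a}ᶜ` and `{b}ᶜ` are forbidden for some `a ≠ b`, the
latter otherwise. -/
lemma exists_pair_or_center (hr : 0 < r) (huniv : Finset.univ ∉ N)
    (hinter : ∀ P ∉ N, ∀ Q ∉ N, P ∩ Q ∉ N)
    (hcov : ∀ a b : Fin r, a ≠ b → ({a}ᶜ : Finset (Fin r)) ∉ N ∨ ({b}ᶜ : Finset (Fin r)) ∉ N ∨
      ({a, b}ᶜ : Finset (Fin r)) ∉ N) :
    (∃ a b : Fin r, a ≠ b ∧ ∀ P : Finset (Fin r), a ∉ P → b ∉ P → P ∉ N) ∨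
      ∃ c : Fin r, ∀ P : Finset (Fin r), c ∈ P → P ∉ N := by
  by_cases hab : ∃ a b : Fin r, a ≠ b ∧ ({a}ᶜ : Finset (Fin r)) ∈ N ∧ ({b}ᶜ : Finset (Fin r)) ∈ N
  · obtain ⟨a, b, hne, ha, hb⟩ := hab
    left
    refine ⟨a, b, hne, fun P haP hbP => ?_⟩
    have h₀ : ({a, b}ᶜ : Finset (Fin r)) ∉ N := by
      rcases hcov a b hne with h | h | h
      · exact absurd ha h
      · exact absurd hb h
      · exact h
    have h1 := sdiff_notMem hinter h₀ ({a, b}ᶜ \ P) (by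
      intro i hi
      simp only [Finset.mem_sdiff, Finset.mem_compl, Finset.mem_insert, Finset.mem_singleton,
        not_or] at hi
      by_cases hiN : ({i}ᶜ : Finset (Fin r)) ∈ N
      · refine ⟨{a, i}ᶜ, ?_, ?_, by simp⟩
        · rcases hcov a i (Ne.symm hi.1.1) with h | h | h
          · exact absurd ha h
          · exact absurd hiN h
          · exact h
        · intro v hv
          simp only [Finset.mem_erase, Finset.mem_compl, Finset.mem_insert,
            Finset.mem_singleton, not_or] at hv ⊢
          tauto
      · refine ⟨{i}ᶜ, hiN, ?_, by simp⟩
        intro v hv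
        simpa using (Finset.mem_erase.1 hv).1)
    convert h1 using 2
    ext v
    simp only [Finset.mem_sdiff, Finset.mem_compl, Finset.mem_insert, Finset.mem_singleton, not_or,
      not_and, not_not]
    constructor
    · intro hv
      refine ⟨⟨?_, ?_⟩, fun _ => hv⟩
      · rintro rfl; exact haP hv
      · rintro rfl; exact hbP hv
    · rintro ⟨h1, h2⟩
      exact h2 h1
  · right
    push Not at hab
    have hc : ∃ c : Fin r, ∀ i, i ≠ c → ({i}ᶜ : Finset (Fin r)) ∉ N := by
      by_cases h : ∃ c : Fin r, ({c}ᶜ : Finset (Fin r)) ∈ N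
      · obtain ⟨c, hc⟩ := h
        exact ⟨c, fun i hi => hab c i (Ne.symm hi) hc⟩
      · push Not at h
        exact ⟨⟨0, hr⟩, fun i _ => h i⟩
    obtain ⟨c, hc⟩ := hc
    refine ⟨c, fun P hP => ?_⟩
    have h1 := sdiff_notMem hinter huniv Pᶜ (by
      intro i hi
      refine ⟨{i}ᶜ, hc i ?_, ?_, by simp⟩
      · rintro rfl; simp at hi; exact hi hP
      · intro v hv
        simpa using (Finset.mem_erase.1 hv).1)
    simpa using h1

/-- Either an edge of a homogeneous `r`-graph is determined by some `r - 2` of its vertices, or all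
patterns missing two fixed colours are allowed, or all patterns containing a fixed colour are
allowed. -/
lemma Homogeneous.trichotomy {n : ℕ} {χ : Fin n → Fin r} {F : Finset (Finset (Fin n))}
    (h : Homogeneous M χ N F) (hne : F.Nonempty) (hr : 0 < r) (hM : 2 * r ≤ M) :
    F.card ≤ n.choose (r - 2) ∨
    (∃ a b : Fin r, a ≠ b ∧ ∀ P : Finset (Fin r), a ∉ P → b ∉ P → P ∉ N) ∨
      ∃ c : Fin r, ∀ P : Finset (Fin r), c ∈ P → P ∉ N := by
  by_cases hcov : ∀ a b : Fin r, a ≠ b → ({a}ᶜ : Finset (Fin r)) ∉ N ∨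
      ({b}ᶜ : Finset (Fin r)) ∉ N ∨ ({a, b}ᶜ : Finset (Fin r)) ∉ N
  · right
    exact exists_pair_or_center hr (h.univ_notMem hne)
      (fun P hP Q hQ => h.inter_notMem hne hM hP hQ) hcov
  · left
    push Not at hcov
    obtain ⟨a, b, hab, ha, hb, h3⟩ := hcov
    have hcard : ({a, b}ᶜ : Finset (Fin r)).card = r - 2 := by
      rw [Finset.card_compl, Finset.card_pair hab, Fintype.card_fin]
    rw [← hcard]
    refine h.card_le_of_forall_superset_mem fun Q hQ hQu => ?_
    have hQ' : ∀ v, v ≠ a → v ≠ b → v ∈ Q := fun v h1 h2 => hQ (by simp [h1, h2])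
    by_cases haQ : a ∈ Q
    · have hbQ : b ∉ Q := by
        intro hbQ
        apply hQu
        ext v
        by_cases h1 : v = a <;> by_cases h2 : v = b <;> simp_all
      convert hb using 1
      ext v
      by_cases h1 : v = a <;> by_cases h2 : v = b <;> simp_all
    · by_cases hbQ : b ∈ Q
      · convert ha using 1
        ext v
        by_cases h1 : v = a <;> by_cases h2 : v = b <;> simp_all
      · convert h3 using 1
        ext v
        by_cases h1 : v = a <;> by_cases h2 : v = b <;> simp_all

/-- Either an edge of a homogeneous `r`-graph is determined by some `r - 1` of its vertices, or all
patterns are allowed. -/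
lemma Homogeneous.card_le_or_forall_notMem {n : ℕ} {χ : Fin n → Fin r}
    {F : Finset (Finset (Fin n))} (h : Homogeneous M χ N F) (hne : F.Nonempty) (hM : 2 * r ≤ M) :
    F.card ≤ n.choose (r - 1) ∨ ∀ P : Finset (Fin r), P ∉ N := by
  by_cases hcov : ∃ a : Fin r, ({a}ᶜ : Finset (Fin r)) ∈ N
  · left
    obtain ⟨a, ha⟩ := hcov
    have hcard : ({a}ᶜ : Finset (Fin r)).card = r - 1 := by
      rw [Finset.card_compl, Finset.card_singleton, Fintype.card_fin]
    rw [← hcard]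
    refine h.card_le_of_forall_superset_mem fun Q hQ hQu => ?_
    have hQ' : ∀ v, v ≠ a → v ∈ Q := fun v h1 => hQ (by simp [h1])
    convert ha using 1
    ext v
    by_cases haQ : a ∈ Q
    · exfalso
      apply hQu
      ext v
      by_cases h1 : v = a <;> simp_all
    · by_cases h1 : v = a <;> simp_all
  · right
    push Not at hcov
    intro P
    have h1 := sdiff_notMem (fun P hP Q hQ => h.inter_notMem hne hM hP hQ) (h.univ_notMem hne) Pᶜ
      (fun i _ => ⟨{i}ᶜ, hcov i, fun v hv => by simpa using (Finset.mem_erase.1 hv).1, by simp⟩)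
    simpa using h1

end Patterns

/-! ### Colourings and embeddings of trees -/

section Trees

/-- The sets `E 0, ..., E (m - 1)`, which need not be distinct or of equal size, form a tree: the
part of each that is covered by the earlier ones lies in a single earlier one. -/
def TreeLike {W : Type*} [DecidableEq W] (m : ℕ) (E : ℕ → Finset W) : Prop :=
  ∀ i < m, 0 < i → ∃ j < i, ∀ l < i, E i ∩ E l ⊆ E j

variable {W : Type*} [DecidableEq W]

lemma TreeLike.sdiff {m : ℕ} {E : ℕ → Finset W} (h : TreeLike m E) (Z : Finset W) :
    TreeLike m (fun i => E i \ Z) := by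
  intro i hi hi0
  obtain ⟨j, hj, hjl⟩ := h i hi hi0
  refine ⟨j, hj, fun l hl w hw => ?_⟩
  simp only [Finset.mem_inter, Finset.mem_sdiff] at hw ⊢
  exact ⟨hjl l hl (Finset.mem_inter.2 ⟨hw.1.1, hw.2.1⟩), hw.1.2⟩

/-- Replacing the sets that miss a vertex `v` by `{v}` keeps a tree. -/
lemma TreeLike.star {m : ℕ} {E : ℕ → Finset W} (h : TreeLike m E) (v : W) :
    TreeLike m (fun i => if v ∈ E i then E i else {v}) := by
  have hv : ∀ i, v ∈ (if v ∈ E i then E i else {v}) := by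
    intro i; split_ifs with h1 <;> simp [h1]
  intro i hi hi0
  obtain ⟨j, hj, hjl⟩ := h i hi hi0
  by_cases hex : v ∈ E i ∧ ∃ l < i, v ∈ E l
  · obtain ⟨hvi, l₀, hl₀, hvl₀⟩ := hex
    have hvj : v ∈ E j := hjl l₀ hl₀ (Finset.mem_inter.2 ⟨hvi, hvl₀⟩)
    refine ⟨j, hj, fun l hl w hw => ?_⟩
    simp only [hvi, hvj, if_true] at hw ⊢
    by_cases hvl : v ∈ E l
    · simp only [hvl, if_true] at hw
      exact hjl l hl hw
    · simp only [hvl, if_false, Finset.mem_inter, Finset.mem_singleton] at hw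
      exact hw.2 ▸ hvj
  · refine ⟨0, hi0, fun l hl w hw => ?_⟩
    have hwv : w = v := by
      rw [Finset.mem_inter] at hw
      by_cases hvi : v ∈ E i
      · have hvl : v ∉ E l := fun hvl => hex ⟨hvi, l, hl, hvl⟩
        simpa [hvl] using hw.2
      · simpa [hvi] using hw.1
    rw [hwv]
    exact hv 0

lemma IsTree.exists_treeLike {T : Finset (Finset W)} (h : IsTree T) :
    ∃ (m : ℕ) (E : ℕ → Finset W), TreeLike m E ∧ (∀ A, A ∈ T ↔ ∃ i < m, E i = A) ∧
      ∀ i < m, ∀ j < m, E i = E j → i = j := by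
  obtain ⟨m, E, hinj, hmem, htree⟩ := h
  refine ⟨m, fun i => if h : i < m then E ⟨i, h⟩ else ∅, ?_, ?_, ?_⟩
  · intro i hi hi0
    obtain ⟨j, hj, hjs⟩ := htree ⟨i, hi⟩ hi0
    refine ⟨j, hj, fun l hl w hw => ?_⟩
    have hlm : l < m := hl.trans hi
    simp only [hi, hlm, dif_pos, Finset.mem_inter, j.2] at hw ⊢
    apply hjs
    simp only [Finset.mem_inter, Finset.mem_biUnion, Finset.mem_Iio]
    exact ⟨hw.1, ⟨l, hlm⟩, hl, hw.2⟩
  · intro A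
    rw [hmem]
    constructor
    · rintro ⟨i, rfl⟩
      exact ⟨i, i.2, by simp⟩
    · rintro ⟨i, hi, h⟩
      simp only [hi, dif_pos] at h
      exact ⟨_, h⟩
  · intro i hi j hj h
    simp only [hi, hj, dif_pos] at h
    simpa using hinj h

lemma exists_private_pair {T : Finset (Finset W)} (hT : IsReducible 2 T) {A : Finset W}
    (hA : A ∈ T) : ∃ p q, p ≠ q ∧ p ∈ A ∧ q ∈ A ∧ (∀ B ∈ T, p ∈ B → B = A) ∧
      ∀ B ∈ T, q ∈ B → B = A := by
  have hdeg : ∀ p ∈ A, degree T p = 1 → ∀ B ∈ T, p ∈ B → B = A := by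
    intro p hp hd B hB hpB
    exact Finset.card_le_one.1 hd.le B (Finset.mem_filter.2 ⟨hB, hpB⟩) A
      (Finset.mem_filter.2 ⟨hA, hp⟩)
  obtain ⟨p, hp, q, hq, hpq⟩ := Finset.one_lt_card.1 (hT A hA)
  rw [Finset.mem_filter] at hp hq
  exact ⟨p, q, hpq, hp.1, hq.1, hdeg p hp.1 hp.2, hdeg q hq.1 hq.2⟩

lemma exists_extend_coloring {β : Type*} [DecidableEq β] {K : Finset β} {κ : W → β}
    {B E : Finset W} (hB : B ⊆ E) (hinj : Set.InjOn κ (B : Set W)) (hK : ∀ w ∈ B, κ w ∈ K)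
    (hcard : E.card ≤ K.card) :
    ∃ κ' : W → β, (∀ w, w ∉ E \ B → κ' w = κ w) ∧ Set.InjOn κ' (E : Set W) ∧
      ∀ w ∈ E, κ' w ∈ K := by
  have h1 : Fintype.card ↥(E \ B) ≤ Fintype.card ↥(K \ B.image κ) := by
    simp only [Fintype.card_coe]
    have h2 : B.image κ ⊆ K := by
      intro x hx
      obtain ⟨w, hw, rfl⟩ := Finset.mem_image.1 hx
      exact hK w hw
    rw [Finset.card_sdiff_of_subset hB, Finset.card_sdiff_of_subset h2,
      Finset.card_image_of_injOn hinj]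
    omega
  obtain ⟨g⟩ := Function.Embedding.nonempty_of_card_le h1
  have hg : ∀ w, (g w : β) ∈ K ∧ (g w : β) ∉ B.image κ := fun w => Finset.mem_sdiff.1 (g w).2
  refine ⟨fun w => if h : w ∈ E \ B then g ⟨w, h⟩ else κ w, ?_, ?_, ?_⟩
  · intro w hw
    simp [hw]
  · intro u hu w hw huw
    have hu' : u ∈ E := hu
    have hw' : w ∈ E := hw
    by_cases huB : u ∈ B <;> by_cases hwB : w ∈ B
    · simp only [Finset.mem_sdiff, huB, hwB, not_true, and_false, dif_neg, not_false_iff] at huw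
      exact hinj huB hwB huw
    · simp only [Finset.mem_sdiff, huB, hwB, hw', not_true, not_false_iff, and_false, and_true,
        dif_neg, dif_pos] at huw
      exact absurd (Finset.mem_image.2 ⟨u, huB, huw⟩) (hg _).2
    · simp only [Finset.mem_sdiff, huB, hwB, hu', not_true, not_false_iff, and_false, and_true,
        dif_neg, dif_pos] at huw
      exact absurd (Finset.mem_image.2 ⟨w, hwB, huw.symm⟩) (hg _).2
    · simp only [Finset.mem_sdiff, huB, hwB, hu', hw', not_false_iff, and_true, dif_pos] at huw
      have := g.injective (Subtype.ext huw)
      simpa using this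
  · intro w hw
    by_cases hwB : w ∈ B
    · simpa [hwB] using hK w hwB
    · simpa [hw, hwB] using (hg ⟨w, Finset.mem_sdiff.2 ⟨hw, hwB⟩⟩).1

/-- Trees are properly colourable with as many colours as the size of their largest set. -/
lemma TreeLike.exists_coloring {β : Type*} [Nonempty β] {m : ℕ} {E : ℕ → Finset W}
    (h : TreeLike m E) (K : Finset β) (hcard : ∀ i < m, (E i).card ≤ K.card) :
    ∃ κ : W → β, ∀ i < m, Set.InjOn κ (E i : Set W) ∧ ∀ w ∈ E i, κ w ∈ K := by
  classical
  suffices ∀ k ≤ m, ∃ κ : W → β, ∀ i < k, Set.InjOn κ (E i : Set W) ∧ ∀ w ∈ E i, κ w ∈ K from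
    this m le_rfl
  intro k
  induction k with
  | zero => exact fun _ => ⟨fun _ => Classical.arbitrary β, by simp⟩
  | succ k ih =>
    intro hk
    obtain ⟨κ, hκ⟩ := ih (by omega)
    set B := (E k).filter (fun w => ∃ l < k, w ∈ E l) with hBdef
    have hB : Set.InjOn κ (B : Set W) ∧ ∀ w ∈ B, κ w ∈ K := by
      rcases Nat.eq_zero_or_pos k with rfl | hk0
      · simp [hBdef]
      · obtain ⟨j, hj, hjl⟩ := h k (by omega) hk0
        have hBj : B ⊆ E j := by
          intro w hw
          obtain ⟨hw1, l, hl, hwl⟩ := Finset.mem_filter.1 hw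
          exact hjl l hl (Finset.mem_inter.2 ⟨hw1, hwl⟩)
        exact ⟨(hκ j hj).1.mono hBj, fun w hw => (hκ j hj).2 w (hBj hw)⟩
    obtain ⟨κ', h1, h2, h3⟩ := exists_extend_coloring (E := E k) (Finset.filter_subset _ _)
      hB.1 hB.2 (hcard k (by omega))
    refine ⟨κ', fun i hi => ?_⟩
    rcases Nat.lt_succ_iff_lt_or_eq.1 hi with hi | rfl
    · have heq : ∀ w ∈ E i, κ' w = κ w := by
        intro w hw
        apply h1
        simp only [Finset.mem_sdiff, not_and, not_not]
        exact fun hwk => Finset.mem_filter.2 ⟨hwk, i, hi, hw⟩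
      refine ⟨fun u hu w hw huw => (hκ i hi).1 hu hw ?_, fun w hw => ?_⟩
      · rw [← heq u hu, ← heq w hw, huw]
      · rw [heq w hw]; exact (hκ i hi).2 w hw
    · exact ⟨h2, h3⟩

/-- Greedy embedding of a coloured tree into a homogeneous family, when the colour patterns of the
intersections along the tree are all allowed. -/
lemma Homogeneous.exists_embedding [Fintype W] {α : Type*} [DecidableEq α] {r M : ℕ}
    {χ : α → Fin r} {N : Finset (Finset (Fin r))} {F : Finset (Finset α)}
    (hF : Homogeneous M χ N F) (hne : F.Nonempty) (hM : Fintype.card W ≤ M)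
    {m : ℕ} {E : ℕ → Finset W} {κ : W → Fin r} (hκ : ∀ i < m, Set.InjOn κ (E i : Set W))
    (hT : ∀ i < m, 0 < i → ∃ j < i, (∀ l < i, E i ∩ E l ⊆ E j) ∧ (E i ∩ E j).image κ ∉ N) :
    ∃ f : W → α, Set.InjOn f {w | ∃ i < m, w ∈ E i} ∧ ∀ i < m, ∃ G ∈ F, (E i).image f ⊆ G := by
  suffices ∀ k ≤ m, ∃ f : W → α, Set.InjOn f {w | ∃ i < k, w ∈ E i} ∧
      (∀ i < k, ∀ w ∈ E i, χ (f w) = κ w) ∧ ∀ i < k, ∃ G ∈ F, (E i).image f ⊆ G by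
    obtain ⟨f, h1, -, h2⟩ := this m le_rfl
    exact ⟨f, h1, h2⟩
  intro k
  induction k with
  | zero =>
    intro _
    obtain ⟨G, hG⟩ := hne
    by_cases hW : IsEmpty W
    · exact ⟨fun w => (hW.false w).elim, by simp [Set.InjOn], by simp, by simp⟩
    · by_cases hα : Nonempty α
      · exact ⟨fun _ => Classical.arbitrary α, by simp [Set.InjOn], by simp, by simp⟩
      · -- An edge has a vertex of each colour, so `α` is empty only if there are no colours.
        exfalso
        rw [not_isEmpty_iff] at hW
        obtain ⟨w⟩ := hW
        obtain ⟨v, -⟩ := exists_mem_color_eq (hF.rainbow G hG) (hF.card_eq G hG) (κ w)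
        exact hα ⟨v⟩
  | succ k ih =>
    intro hk
    obtain ⟨f, hf, hcol, hemb⟩ := ih (by omega)
    -- `G` receives the new set; it meets the old image only in the image of the old vertices.
    have hG : ∃ G ∈ F, (∀ w ∈ E k, ∀ l < k, w ∈ E l → f w ∈ G) ∧
        (∀ w ∈ E k, (∀ l < k, w ∉ E l) → ∀ v ∈ G, χ v = κ w → ∀ l < k, ∀ u ∈ E l, f u ≠ v) := by
      rcases Nat.eq_zero_or_pos k with rfl | hk0
      · obtain ⟨G, hG⟩ := hne
        exact ⟨G, hG, by simp, by simp⟩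
      · obtain ⟨j, hj, hjl, hjN⟩ := hT k (by omega) hk0
        obtain ⟨Gj, hGj, hGjs⟩ := hemb j hj
        set X := ((Finset.range k).biUnion E).image f
        obtain ⟨G, hG, hGs, hGd⟩ := hF.rich _ hjN Gj hGj X
          ((Finset.card_image_le.trans (Finset.card_le_univ _)).trans hM)
        refine ⟨G, hG, ?_, ?_⟩
        · intro w hw l hl hwl
          have hwj : w ∈ E j := hjl l hl (Finset.mem_inter.2 ⟨hw, hwl⟩)
          apply hGs
          refine mem_part.2 ⟨hGjs (Finset.mem_image_of_mem _ hwj), ?_⟩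
          rw [hcol j hj w hwj]
          exact Finset.mem_image_of_mem _ (Finset.mem_inter.2 ⟨hw, hwj⟩)
        · rintro w hw hnew v hv hvc l hl u hu rfl
          have hX : f u ∈ X := Finset.mem_image_of_mem _
            (Finset.mem_biUnion.2 ⟨l, Finset.mem_range.2 hl, hu⟩)
          have h1 : f u ∈ part χ ((E k ∩ E j).image κ) Gj := by
            by_contra h
            exact Finset.disjoint_left.1 hGd (Finset.mem_sdiff.2 ⟨hv, h⟩) hX
          have h2 := (mem_part.1 h1).2
          rw [hvc] at h2
          obtain ⟨w', hw', hww⟩ := Finset.mem_image.1 h2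
          rw [Finset.mem_inter] at hw'
          have := hκ k (by omega) hw'.1 hw hww
          exact hnew j hj (this ▸ hw'.2)
    obtain ⟨G, hGF, hGold, hGnew⟩ := hG
    choose g hgG hgc using exists_mem_color_eq (hF.rainbow G hGF) (hF.card_eq G hGF)
    classical
    set f' : W → α := fun w => if ∃ l < k, w ∈ E l then f w else g (κ w) with hf'
    have hold : ∀ l < k, ∀ w ∈ E l, f' w = f w := fun l hl w hw => if_pos ⟨l, hl, hw⟩
    have hnew : ∀ w, (∀ l < k, w ∉ E l) → f' w = g (κ w) := by
      intro w hw
      apply if_neg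
      push Not
      exact hw
    have hcases : ∀ w, (∃ i < k + 1, w ∈ E i) →
        (∃ l < k, w ∈ E l) ∨ (w ∈ E k ∧ ∀ l < k, w ∉ E l) := by
      rintro w ⟨i, hi, hw⟩
      by_cases h : ∃ l < k, w ∈ E l
      · exact Or.inl h
      · push Not at h
        rcases Nat.lt_succ_iff_lt_or_eq.1 hi with hi | rfl
        · exact absurd hw (h i hi)
        · exact Or.inr ⟨hw, h⟩
    have hcol' : ∀ i < k + 1, ∀ w ∈ E i, χ (f' w) = κ w := by
      intro i hi w hw
      rcases hcases w ⟨i, hi, hw⟩ with ⟨l, hl, hwl⟩ | ⟨-, h⟩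
      · rw [hold l hl w hwl, hcol l hl w hwl]
      · rw [hnew w h, hgc]
    refine ⟨f', ?_, hcol', ?_⟩
    · intro u hu w hw huw
      rcases hcases u hu with ⟨l, hl, hul⟩ | ⟨huk, hun⟩ <;>
      rcases hcases w hw with ⟨l', hl', hwl'⟩ | ⟨hwk, hwn⟩
      · rw [hold l hl u hul, hold l' hl' w hwl'] at huw
        exact hf ⟨l, hl, hul⟩ ⟨l', hl', hwl'⟩ huw
      · rw [hold l hl u hul, hnew w hwn] at huw
        exact absurd huw (hGnew w hwk hwn _ (hgG _) (hgc _) l hl u hul)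
      · rw [hold l' hl' w hwl', hnew u hun] at huw
        exact absurd huw.symm (hGnew u huk hun _ (hgG _) (hgc _) l' hl' w hwl')
      · apply hκ k (by omega) huk hwk
        rw [← hcol' k (by omega) u huk, ← hcol' k (by omega) w hwk, huw]
    · intro i hi
      rcases Nat.lt_succ_iff_lt_or_eq.1 hi with hi | rfl
      · obtain ⟨G', hG', hs⟩ := hemb i hi
        refine ⟨G', hG', ?_⟩
        rw [Finset.image_congr (g := f) (fun w hw => hold i hi w hw)]
        exact hs
      · refine ⟨G, hGF, ?_⟩
        intro v hv
        obtain ⟨w, hw, rfl⟩ := Finset.mem_image.1 hv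
        rcases hcases w ⟨i, hi, hw⟩ with ⟨l, hl, hwl⟩ | ⟨-, h⟩
        · rw [hold l hl w hwl]
          exact hGold w hw l hl hwl
        · rw [hnew w h]
          exact hgG _

end Trees

/-! ### Embedding subgraphs of trees -/

section Embedding

variable {V W : Type*} [Fintype V] [DecidableEq V] [DecidableEq W]

/-- A map of the non-isolated vertices extends to the isolated ones. -/
lemma Embeds.of_injOn {n : ℕ} {H : Finset (Finset V)} {F : Finset (Finset (Fin n))}
    (hn : Fintype.card V ≤ n) (φ : V → Fin n) (hφ : Set.InjOn φ {v | ∃ A ∈ H, v ∈ A})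
    (hF : ∀ A ∈ H, A.image φ ∈ F) : Embeds H F := by
  obtain ⟨ψ, h1, h2, -⟩ := exists_extend_coloring (K := (Finset.univ : Finset (Fin n))) (κ := φ)
    (B := H.biUnion id) (E := Finset.univ) (Finset.subset_univ _)
    (by
      intro u hu v hv
      simp only [Finset.coe_biUnion, id, Set.mem_iUnion, Finset.mem_coe] at hu hv
      obtain ⟨A, hA, hu⟩ := hu
      obtain ⟨B, hB, hv⟩ := hv
      exact hφ ⟨A, hA, hu⟩ ⟨B, hB, hv⟩) (by simp) (by simpa using hn)
  refine ⟨⟨ψ, fun u v h => h2 (by simp) (by simp) h⟩, fun A hA => ?_⟩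
  rw [Finset.map_eq_image]
  convert hF A hA using 1
  refine Finset.image_congr fun v hv => ?_
  apply h1
  simp only [Finset.mem_sdiff, Finset.mem_univ, true_and, not_not, Finset.mem_biUnion]
  exact ⟨A, hA, hv⟩

lemma Embeds.of_tree {n r m : ℕ} {H : Finset (Finset V)} {F : Finset (Finset (Fin n))}
    (hn : Fintype.card V ≤ n) (hH : (H : Set (Finset V)).Sized r) (hF : ∀ G ∈ F, G.card = r)
    {E : ℕ → Finset W} {e : V ↪ W} (he : ∀ A ∈ H, ∃ i < m, E i = A.map e) {f : W → Fin n}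
    (hf : Set.InjOn f {w | ∃ i < m, w ∈ E i}) (hfF : ∀ i < m, ∃ G ∈ F, (E i).image f ⊆ G) :
    Embeds H F := by
  have hmem : ∀ A ∈ H, ∀ v ∈ A, e v ∈ {w | ∃ i < m, w ∈ E i} := by
    intro A hA v hv
    obtain ⟨i, hi, h⟩ := he A hA
    exact ⟨i, hi, h ▸ Finset.mem_map_of_mem e hv⟩
  have hinj : Set.InjOn (f ∘ e) {v | ∃ A ∈ H, v ∈ A} := by
    rintro u ⟨A, hA, hu⟩ v ⟨B, hB, hv⟩ huv
    exact e.injective (hf (hmem A hA u hu) (hmem B hB v hv) huv)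
  refine Embeds.of_injOn hn (f ∘ e) hinj fun A hA => ?_
  obtain ⟨i, hi, h⟩ := he A hA
  obtain ⟨G, hG, hs⟩ := hfF i hi
  have h1 : A.image (f ∘ e) ⊆ G := by
    rw [← Finset.image_image, ← Finset.map_eq_image, ← h]
    exact hs
  have h2 : (A.image (f ∘ e)).card = r := by
    rw [Finset.card_image_of_injOn (hinj.mono fun v hv => Exists.intro A ⟨hA, hv⟩), hH hA]
  rw [Finset.eq_of_subset_of_card_le h1 (by rw [h2, hF G hG])]
  exact hG

variable [Fintype W]

/-- A `k`-graph on `n` vertices that does not contain a given tree has `O(n ^ (k - 1))` edges. -/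
lemma TreeLike.exists_card_le {m k : ℕ} {E : ℕ → Finset W} (hE : TreeLike m E) (hk : 0 < k)
    (hcard : ∀ i < m, (E i).card ≤ k) :
    ∃ C : ℕ, ∀ (n : ℕ) (F : Finset (Finset (Fin n))), (F : Set (Finset (Fin n))).Sized k →
      (¬ ∃ f : W → Fin n, Set.InjOn f {w | ∃ i < m, w ∈ E i} ∧
        ∀ i < m, ∃ G ∈ F, (E i).image f ⊆ G) → F.card ≤ C * n ^ (k - 1) := by
  obtain ⟨C, hC⟩ := exists_homogeneous k (Fintype.card W + 2 * k) hk
  refine ⟨C, fun n F hF hno => ?_⟩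
  obtain ⟨χ, N, G, hGF, hG, hle⟩ := hC n F hF
  refine hle.trans (Nat.mul_le_mul_left _ ?_)
  rcases G.eq_empty_or_nonempty with rfl | hne
  · simp
  rcases hG.card_le_or_forall_notMem hne (by omega) with h | h
  · exact h.trans (Nat.choose_le_pow _ _)
  · exfalso
    have : Nonempty (Fin k) := ⟨⟨0, hk⟩⟩
    obtain ⟨κ, hκ⟩ := hE.exists_coloring (Finset.univ : Finset (Fin k)) (by simpa using hcard)
    obtain ⟨f, hf, hfG⟩ := hG.exists_embedding hne (by omega) (fun i hi => (hκ i hi).1)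
      (fun i hi hi0 => by
        obtain ⟨j, hj, hjl⟩ := hE i hi hi0
        exact ⟨j, hj, hjl, h _⟩)
    refine hno ⟨f, hf, fun i hi => ?_⟩
    obtain ⟨A, hA, hs⟩ := hfG i hi
    exact ⟨A, hGF hA, hs⟩

/-- If all patterns missing the colours `a` and `b` are allowed, a `2`-reducible tree embeds: in
each of its edges, `a` and `b` are given to two vertices of degree one. -/
lemma Homogeneous.exists_embedding_of_pair {n m r M : ℕ} {χ : Fin n → Fin r}
    {N : Finset (Finset (Fin r))} {F : Finset (Finset (Fin n))} (hF : Homogeneous M χ N F)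
    (hne : F.Nonempty) (hM : Fintype.card W ≤ M) {E : ℕ → Finset W} (hE : TreeLike m E)
    (hcard : ∀ i < m, (E i).card = r) {p q : ℕ → W} (hpq : ∀ i < m, p i ≠ q i)
    (hpE : ∀ i < m, p i ∈ E i) (hqE : ∀ i < m, q i ∈ E i)
    (hp : ∀ i < m, ∀ j < m, p i ∈ E j → j = i) (hq : ∀ i < m, ∀ j < m, q i ∈ E j → j = i)
    {a b : Fin r} (hab : a ≠ b) (hN : ∀ P : Finset (Fin r), a ∉ P → b ∉ P → P ∉ N) :
    ∃ f : W → Fin n, Set.InjOn f {w | ∃ i < m, w ∈ E i} ∧ ∀ i < m, ∃ G ∈ F, (E i).image f ⊆ G := by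
  set Z := (Finset.range m).image p ∪ (Finset.range m).image q with hZ
  have hZmem : ∀ w, w ∈ Z ↔ (∃ i < m, p i = w) ∨ ∃ i < m, q i = w := by
    intro w; simp [hZ]
  have : Nonempty (Fin r) := ⟨a⟩
  obtain ⟨κ, hκ⟩ := (hE.sdiff Z).exists_coloring ({a, b}ᶜ : Finset (Fin r)) (by
    intro i hi
    have h1 : E i \ Z ⊆ ((E i).erase (p i)).erase (q i) := by
      intro w hw
      rw [Finset.mem_sdiff, hZmem] at hw
      push Not at hw
      exact Finset.mem_erase.2 ⟨(hw.2.2 i hi).symm, Finset.mem_erase.2 ⟨(hw.2.1 i hi).symm, hw.1⟩⟩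
    refine (Finset.card_le_card h1).trans ?_
    rw [Finset.card_erase_of_mem (Finset.mem_erase.2 ⟨(hpq i hi).symm, hqE i hi⟩),
      Finset.card_erase_of_mem (hpE i hi), hcard i hi, Finset.card_compl, Finset.card_pair hab,
      Fintype.card_fin]
    omega)
  classical
  set κ' : W → Fin r := fun w => if ∃ i < m, p i = w then a else if ∃ i < m, q i = w then b else κ w
    with hκ'
  have hκp : ∀ i < m, κ' (p i) = a := fun i hi => if_pos ⟨i, hi, rfl⟩
  have hκq : ∀ i < m, κ' (q i) = b := by
    intro i hi
    have h1 : ¬ ∃ j < m, p j = q i := by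
      rintro ⟨j, hj, h⟩
      have := hp j hj i hi (h ▸ hqE i hi)
      subst this
      exact hpq i hi h
    simp only [hκ', h1, if_false]
    exact if_pos ⟨i, hi, rfl⟩
  have hκo : ∀ w, w ∉ Z → κ' w = κ w := by
    intro w hw
    rw [hZmem, not_or] at hw
    simp only [hκ', hw.1, hw.2, if_false]
  have hcase : ∀ i < m, ∀ w ∈ E i, w = p i ∨ w = q i ∨ w ∈ E i \ Z := by
    intro i hi w hw
    by_cases hwZ : w ∈ Z
    · rcases (hZmem w).1 hwZ with ⟨j, hj, rfl⟩ | ⟨j, hj, rfl⟩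
      · rw [hp j hj i hi hw]; exact Or.inl rfl
      · rw [hq j hj i hi hw]; exact Or.inr (Or.inl rfl)
    · exact Or.inr (Or.inr (Finset.mem_sdiff.2 ⟨hw, hwZ⟩))
  have hval : ∀ i < m, ∀ w ∈ E i \ Z, κ' w = κ w ∧ κ' w ≠ a ∧ κ' w ≠ b := by
    intro i hi w hw
    have h1 := hκo w (Finset.mem_sdiff.1 hw).2
    have h2 := (hκ i hi).2 w hw
    simp only [Finset.mem_compl, Finset.mem_insert, Finset.mem_singleton, not_or] at h2
    rw [h1]
    exact ⟨rfl, h2⟩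
  refine hF.exists_embedding hne hM (κ := κ') ?_ ?_
  · intro i hi u hu w hw huw
    have hp' := hκp i hi
    have hq' := hκq i hi
    rcases hcase i hi u hu with rfl | rfl | hu <;> rcases hcase i hi w hw with rfl | rfl | hw
    · rfl
    · rw [hp', hq'] at huw; exact absurd huw hab
    · rw [hp'] at huw; exact absurd huw.symm (hval i hi w hw).2.1
    · rw [hp', hq'] at huw; exact absurd huw.symm hab
    · rfl
    · rw [hq'] at huw; exact absurd huw.symm (hval i hi w hw).2.2
    · rw [hp'] at huw; exact absurd huw (hval i hi u hu).2.1
    · rw [hq'] at huw; exact absurd huw (hval i hi u hu).2.2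
    · rw [(hval i hi u hu).1, (hval i hi w hw).1] at huw
      exact (hκ i hi).1 hu hw huw
  · intro i hi hi0
    obtain ⟨j, hj, hjl⟩ := hE i hi hi0
    have hout : ∀ w ∈ E i ∩ E j, κ' w ≠ a ∧ κ' w ≠ b := by
      intro w hw
      rw [Finset.mem_inter] at hw
      rcases hcase i hi w hw.1 with rfl | rfl | hwZ
      · exact absurd (hp i hi j (by omega) hw.2) (by omega)
      · exact absurd (hq i hi j (by omega) hw.2) (by omega)
      · exact (hval i hi w hwZ).2
    refine ⟨j, hj, hjl, hN _ ?_ ?_⟩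
    · intro h
      obtain ⟨w, hw, h⟩ := Finset.mem_image.1 h
      exact (hout w hw).1 h
    · intro h
      obtain ⟨w, hw, h⟩ := Finset.mem_image.1 h
      exact (hout w hw).2 h

/-- If all patterns containing the colour `c` are allowed, a tree all of whose sets contain a
vertex `v` embeds: `v` is given the colour `c`. -/
lemma Homogeneous.exists_embedding_of_center {n m r M : ℕ} {χ : Fin n → Fin r}
    {N : Finset (Finset (Fin r))} {F : Finset (Finset (Fin n))} (hF : Homogeneous M χ N F)
    (hne : F.Nonempty) (hM : Fintype.card W ≤ M) {E : ℕ → Finset W} (hE : TreeLike m E)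
    (hcard : ∀ i < m, (E i).card ≤ r) {v : W} (hv : ∀ i < m, v ∈ E i)
    {c : Fin r} (hN : ∀ P : Finset (Fin r), c ∈ P → P ∉ N) :
    ∃ f : W → Fin n, Set.InjOn f {w | ∃ i < m, w ∈ E i} ∧ ∀ i < m, ∃ G ∈ F, (E i).image f ⊆ G := by
  have : Nonempty (Fin r) := ⟨c⟩
  obtain ⟨κ, hκ⟩ := (hE.sdiff {v}).exists_coloring ({c}ᶜ : Finset (Fin r)) (by
    intro i hi
    have h1 := hcard i hi
    rw [Finset.card_sdiff_of_subset (by simpa using hv i hi), Finset.card_compl,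
      Finset.card_singleton, Finset.card_singleton, Fintype.card_fin]
    omega)
  have hval : ∀ i < m, ∀ w ∈ E i, w ≠ v → w ∈ E i \ {v} ∧ κ w ≠ c := by
    intro i hi w hw hwv
    have h1 : w ∈ E i \ {v} := by simp [hw, hwv]
    exact ⟨h1, by simpa using (hκ i hi).2 w h1⟩
  refine hF.exists_embedding hne hM (κ := fun w => if w = v then c else κ w) ?_ ?_
  · intro i hi u hu w hw huw
    by_cases huv : u = v <;> by_cases hwv : w = v
    · rw [huv, hwv]
    · simp only [huv, hwv, if_true, if_false] at huw
      exact absurd huw.symm (hval i hi w hw hwv).2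
    · simp only [huv, hwv, if_true, if_false] at huw
      exact absurd huw (hval i hi u hu huv).2
    · simp only [huv, hwv, if_false] at huw
      exact (hκ i hi).1 (hval i hi u hu huv).1 (hval i hi w hw hwv).1 huw
  · intro i hi hi0
    obtain ⟨j, hj, hjl⟩ := hE i hi hi0
    refine ⟨j, hj, hjl, hN _ (Finset.mem_image.2 ⟨v, ?_, if_pos rfl⟩)⟩
    exact Finset.mem_inter.2 ⟨hv i hi, hv j (by omega)⟩

/-- Let `S` be a cross-cut of `H`. The traces on the complement of `S` of the edges of a tree
containing `H` extend to a tree of sets of size at most `r - 1`, once edges of the tree that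
miss `S` are deprived of a vertex of degree one. Therefore, in an `H`-free `F`, the common link of
distinct vertices, one for each element of `S`, has `O(n ^ (r - 2))` edges. -/
lemma exists_card_link_le {r m : ℕ} (hr : 2 ≤ r) {H : Finset (Finset V)}
    (hH : (H : Set (Finset V)).Sized r) {E : ℕ → Finset W} (hE : TreeLike m E)
    (hcard : ∀ i < m, (E i).card = r) {p : ℕ → W} (hpE : ∀ i < m, p i ∈ E i)
    (hp : ∀ i < m, ∀ j < m, p i ∈ E j → j = i) {e : V ↪ W}
    (he : ∀ A ∈ H, ∃ i < m, E i = A.map e) {S : Finset V} (hS : IsCrossCut H S) :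
    ∃ C : ℕ, ∀ (n : ℕ), Fintype.card V ≤ n → ∀ F : Finset (Finset (Fin n)), ¬ Embeds H F →
      ∀ y : V → Fin n, Set.InjOn y (S : Set V) → ∀ D : Finset (Finset (Fin n)),
      (D : Set (Finset (Fin n))).Sized (r - 1) →
      (∀ s ∈ S, ∀ A ∈ D, y s ∉ A ∧ insert (y s) A ∈ F) → D.card ≤ C * n ^ (r - 2) := by
  set Z := S.map e ∪ ((Finset.range m).filter (fun i => Disjoint (E i) (S.map e))).image p with hZ
  have hZmem : ∀ w, w ∈ Z ↔ w ∈ S.map e ∨ ∃ i < m, Disjoint (E i) (S.map e) ∧ p i = w := by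
    intro w
    simp only [hZ, Finset.mem_union, Finset.mem_image, Finset.mem_filter, Finset.mem_range,
      and_assoc]
  obtain ⟨C, hC⟩ := (hE.sdiff Z).exists_card_le (k := r - 1) (by omega) (by
    intro i hi
    have h1 : ∃ w ∈ E i, w ∈ Z := by
      by_cases h : Disjoint (E i) (S.map e)
      · exact ⟨p i, hpE i hi, (hZmem _).2 (Or.inr ⟨i, hi, h, rfl⟩)⟩
      · obtain ⟨w, hw, hwS⟩ := Finset.not_disjoint_iff.1 h
        exact ⟨w, hw, (hZmem _).2 (Or.inl hwS)⟩
    obtain ⟨w, hw, hwZ⟩ := h1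
    have h2 : E i \ Z ⊆ (E i).erase w := by
      intro u hu
      rw [Finset.mem_sdiff] at hu
      refine Finset.mem_erase.2 ⟨?_, hu.1⟩
      rintro rfl
      exact hu.2 hwZ
    refine (Finset.card_le_card h2).trans ?_
    rw [Finset.card_erase_of_mem hw, hcard i hi])
  refine ⟨C, fun n hn F hF y hy D hD hDF => ?_⟩
  have h2 : r - 1 - 1 = r - 2 := by omega
  rw [← h2]
  refine hC n D hD ?_
  rintro ⟨g, hg, hgD⟩
  apply hF
  -- For an edge `A` of `H`, the trace of its copy is the copy of `A \ S`.
  have htrace : ∀ A ∈ H, ∃ i < m, E i \ Z = (A \ S).map e := by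
    intro A hA
    obtain ⟨i, hi, h⟩ := he A hA
    refine ⟨i, hi, ?_⟩
    ext w
    constructor
    · intro hw
      rw [Finset.mem_sdiff, hZmem, not_or] at hw
      rw [h, Finset.mem_map] at hw
      obtain ⟨⟨v, hv, rfl⟩, hw2, -⟩ := hw
      refine Finset.mem_map_of_mem e (Finset.mem_sdiff.2 ⟨hv, fun hvS => ?_⟩)
      exact hw2 (Finset.mem_map_of_mem e hvS)
    · intro hw
      obtain ⟨v, hv, rfl⟩ := Finset.mem_map.1 hw
      rw [Finset.mem_sdiff] at hv
      have hvE : e v ∈ E i := h ▸ Finset.mem_map_of_mem e hv.1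
      rw [Finset.mem_sdiff, hZmem]
      refine ⟨hvE, ?_⟩
      rintro (h1 | ⟨j, hj, hdis, hpj⟩)
      · rw [Finset.mem_map' e] at h1
        exact hv.2 h1
      · have hij := hp j hj i hi (hpj ▸ hvE)
        subst hij
        have h3 : (A ∩ S).Nonempty := by
          rw [← Finset.card_pos, hS A hA]; norm_num
        obtain ⟨s, hs⟩ := h3
        rw [Finset.mem_inter] at hs
        exact Finset.disjoint_left.1 hdis (h ▸ Finset.mem_map_of_mem e hs.1)
          (Finset.mem_map_of_mem e hs.2)
  have hgood : ∀ A ∈ H, ∀ v ∈ A, v ∉ S → e v ∈ {w | ∃ i < m, w ∈ E i \ Z} := by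
    intro A hA v hv hvS
    obtain ⟨i, hi, h⟩ := htrace A hA
    exact ⟨i, hi, h ▸ Finset.mem_map_of_mem e (Finset.mem_sdiff.2 ⟨hv, hvS⟩)⟩
  have himage : ∀ A ∈ H, (A \ S).image (g ∘ e) ∈ D := by
    intro A hA
    obtain ⟨i, hi, h⟩ := htrace A hA
    obtain ⟨B, hB, hs⟩ := hgD i hi
    rw [h, Finset.map_eq_image, Finset.image_image] at hs
    have hc : ((A \ S).image (g ∘ e)).card = r - 1 := by
      rw [Finset.card_image_of_injOn]
      · have h3 := Finset.card_sdiff_add_card_inter A S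
        rw [hS A hA, hH hA] at h3
        omega
      · intro u hu v hv huv
        have hu := Finset.mem_sdiff.1 hu
        have hv := Finset.mem_sdiff.1 hv
        exact e.injective (hg (hgood A hA u hu.1 hu.2) (hgood A hA v hv.1 hv.2) huv)
    rw [Finset.eq_of_subset_of_card_le hs (by rw [hc, hD hB])]
    exact hB
  refine Embeds.of_injOn hn (fun v => if v ∈ S then y v else g (e v)) ?_ ?_
  · rintro u ⟨A, hA, hu⟩ v ⟨B, hB, hv⟩ huv
    by_cases huS : u ∈ S <;> by_cases hvS : v ∈ S
    · simp only [huS, hvS, if_true] at huv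
      exact hy huS hvS huv
    · simp only [huS, hvS, if_true, if_false] at huv
      exfalso
      apply (hDF u huS _ (himage B hB)).1
      exact Finset.mem_image.2 ⟨v, Finset.mem_sdiff.2 ⟨hv, hvS⟩, huv.symm⟩
    · simp only [huS, hvS, if_true, if_false] at huv
      exfalso
      apply (hDF v hvS _ (himage A hA)).1
      exact Finset.mem_image.2 ⟨u, Finset.mem_sdiff.2 ⟨hu, huS⟩, huv⟩
    · simp only [huS, hvS, if_false] at huv
      exact e.injective (hg (hgood A hA u hu huS) (hgood B hB v hv hvS) huv)
  · intro A hA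
    obtain ⟨s, hs⟩ := Finset.card_eq_one.1 (hS A hA)
    have hsA : s ∈ A ∧ s ∈ S := Finset.mem_inter.1 (hs ▸ Finset.mem_singleton_self s)
    have hmem : ∀ v ∈ A, v ∈ S → v = s := by
      intro v hv hvS
      simpa [hs] using Finset.mem_inter.2 ⟨hv, hvS⟩
    convert (hDF s hsA.2 _ (himage A hA)).2 using 1
    ext x
    simp only [Finset.mem_image, Finset.mem_insert, Finset.mem_sdiff, Function.comp]
    constructor
    · rintro ⟨v, hv, rfl⟩
      by_cases hvS : v ∈ S
      · left
        simp [hmem v hv hvS, hsA.2]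
      · right
        exact ⟨v, ⟨hv, hvS⟩, by simp [hvS]⟩
    · rintro (rfl | ⟨v, ⟨hv, hvS⟩, rfl⟩)
      · exact ⟨s, hsA.1, by simp [hsA.2]⟩
      · exact ⟨v, hv, by simp [hvS]⟩

end Embedding

/-! ### Families with small degrees -/

section SmallDegree

open Finset FinsetFamily

lemma choose_succ_le_sq_mul_choose_sub_two {k q : ℕ} (hq : 2 ≤ q) (hk : q ≤ k) :
    (k + 1).choose q ≤ (k + 1) ^ 2 * k.choose (q - 2) := by
  obtain ⟨q, rfl⟩ := Nat.exists_eq_add_of_le' hq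
  obtain ⟨k, rfl⟩ := Nat.exists_eq_add_of_le' (show 1 ≤ k by omega)
  have h1 := Nat.add_one_mul_choose_eq (k + 1) (q + 1)
  have h2 := Nat.add_one_mul_choose_eq k q
  have h3 : k.choose q ≤ (k + 1).choose q := Nat.choose_le_succ k q
  have h4 : (k + 1).choose (q + 1) ≤ (k + 1) * k.choose q := by
    rw [h2]; exact Nat.le_mul_of_pos_right _ (by omega)
  have h5 : (k + 1 + 1).choose (q + 1 + 1) ≤ (k + 1 + 1) * (k + 1).choose (q + 1) := by
    rw [h1]; exact Nat.le_mul_of_pos_right _ (by omega)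
  calc (k + 1 + 1).choose (q + 2) ≤ (k + 1 + 1) * (k + 1).choose (q + 1) := h5
    _ ≤ (k + 1 + 1) * ((k + 1) * k.choose q) := by gcongr
    _ ≤ (k + 1 + 1) * ((k + 1 + 1) * (k + 1).choose q) := by gcongr; omega
    _ = (k + 1 + 1) ^ 2 * (k + 1).choose (q + 2 - 2) := by rw [Nat.add_sub_cancel]; ring

/-- The Lovász form of the Kruskal–Katona theorem for the second shadow: a `q`-graph with at most
`t ^ q` edges has a second shadow larger than a constant times `t ^ (-2)` times its number of
edges. -/
lemma card_le_mul_card_shadow {n q : ℕ} (hq : 2 ≤ q) {𝒜 : Finset (Finset (Fin n))}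
    (h𝒜 : (𝒜 : Set (Finset (Fin n))).Sized q) {t : ℝ} (ht : 0 ≤ t) (hle : (#𝒜 : ℝ) ≤ t ^ q) :
    (#𝒜 : ℝ) ≤ ((q + 1) * q.factorial) ^ 2 * t ^ 2 * (#(∂^[2] 𝒜) : ℝ) := by
  rcases 𝒜.eq_empty_or_nonempty with rfl | hne
  · simp only [card_empty, Nat.cast_zero]; positivity
  have hm : 1 ≤ #𝒜 := hne.card_pos
  have hmn : #𝒜 ≤ n.choose q := by
    have h1 : 𝒜 ⊆ powersetCard q univ := fun A hA => mem_powersetCard.2 ⟨subset_univ _, h𝒜 hA⟩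
    simpa using card_le_card h1
  have hqn : q ≤ n := by
    by_contra h
    rw [Nat.choose_eq_zero_of_lt (by omega)] at hmn
    omega
  set k := Nat.findGreatest (fun k => k.choose q ≤ #𝒜) n with hk
  have hkq : q ≤ k := Nat.le_findGreatest hqn (by simpa using hm)
  have hkn : k ≤ n := Nat.findGreatest_le n
  have hk1 : k.choose q ≤ #𝒜 :=
    Nat.findGreatest_spec (P := fun k => k.choose q ≤ #𝒜) hqn (by simpa using hm)
  have hk2 : #𝒜 ≤ (k + 1).choose q := by
    rcases Nat.lt_or_ge k n with h | h
    · exact (not_le.1 (Nat.findGreatest_is_greatest (P := fun k => k.choose q ≤ #𝒜)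
        (Nat.lt_succ_self k) h)).le
    · have : k = n := le_antisymm hkn h
      rw [this]
      exact hmn.trans (Nat.choose_le_succ n q)
  have hsh := kruskal_katona_lovasz_form (i := 2) hq hkq hkn h𝒜 hk1
  have h1 : #𝒜 ≤ (k + 1) ^ 2 * #(∂^[2] 𝒜) :=
    (hk2.trans (choose_succ_le_sq_mul_choose_sub_two hq hkq)).trans (Nat.mul_le_mul_left _ hsh)
  have h2 : ((k : ℝ) + 1) ≤ (q + 1) * q.factorial * t := by
    have hfac : (1 : ℝ) ≤ q.factorial := by exact_mod_cast q.factorial_pos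
    have h3 : (((k + 1 - q : ℕ) : ℝ)) ^ q ≤ (q.factorial * t) ^ q := by
      have h4 : (((k + 1 - q : ℕ) : ℝ)) ^ q / q.factorial ≤ k.choose q := by
        exact_mod_cast Nat.pow_le_choose (α := ℝ) q k
      rw [div_le_iff₀ (by positivity)] at h4
      have h5 : (k.choose q : ℝ) ≤ t ^ q := le_trans (by exact_mod_cast hk1) hle
      calc (((k + 1 - q : ℕ) : ℝ)) ^ q ≤ t ^ q * q.factorial := h4.trans (by gcongr)
        _ ≤ t ^ q * q.factorial ^ q := by
          gcongr
          exact le_self_pow₀ hfac (by omega)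
        _ = _ := by rw [mul_pow]; ring
    have h6 : ((k + 1 - q : ℕ) : ℝ) ≤ q.factorial * t :=
      le_of_pow_le_pow_left₀ (by omega) (by positivity) h3
    have h7 : (k : ℝ) + 1 ≤ (q + 1) * ((k + 1 - q : ℕ) : ℝ) := by
      obtain ⟨j, hj⟩ := Nat.exists_eq_add_of_le hkq
      have : k + 1 ≤ (q + 1) * (k + 1 - q) := by
        have h8 : k + 1 - q = j + 1 := by omega
        rw [h8, hj]
        nlinarith
      exact_mod_cast this
    calc (k : ℝ) + 1 ≤ (q + 1) * ((k + 1 - q : ℕ) : ℝ) := h7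
      _ ≤ (q + 1) * (q.factorial * t) := by gcongr
      _ = _ := by ring
  calc (#𝒜 : ℝ) ≤ ((k : ℝ) + 1) ^ 2 * #(∂^[2] 𝒜) := by exact_mod_cast h1
    _ ≤ ((q + 1) * q.factorial * t) ^ 2 * #(∂^[2] 𝒜) := by gcongr
    _ = _ := by ring

/-- Suppose that in a homogeneous family the patterns containing `c` are allowed, and that those
missing exactly `c` and two more colours are forbidden. Then `r - 3` vertices of an edge other than
its vertex of colour `c` determine the latter, so that the second shadows of the links of different
vertices of colour `c` are disjoint. -/
lemma Homogeneous.card_le_of_degree_le {n r M : ℕ} {χ : Fin n → Fin r}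
    {N : Finset (Finset (Fin r))} {F : Finset (Finset (Fin n))} (hF : Homogeneous M χ N F)
    (hM : r ≤ M) (hr : 3 ≤ r) {c : Fin r} (hN : ∀ P : Finset (Fin r), c ∈ P → P ∉ N)
    (hN' : ∀ a b : Fin r, a ≠ b → a ≠ c → b ≠ c → ({a, b, c}ᶜ : Finset (Fin r)) ∈ N)
    {t : ℝ} (ht : 0 ≤ t) (hdeg : ∀ x, (#(F.filter (fun E => x ∈ E)) : ℝ) ≤ t ^ (r - 1)) :
    (#F : ℝ) ≤ (r * (r - 1).factorial) ^ 2 * t ^ 2 * n ^ (r - 3) := by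
  set Fx : Fin n → Finset (Finset (Fin n)) := fun x => F.filter (fun E => x ∈ E ∧ χ x = c) with hFx
  set A : Fin n → Finset (Finset (Fin n)) := fun x => (Fx x).image (fun E => E.erase x) with hA
  have hFxmem : ∀ x E, E ∈ Fx x ↔ E ∈ F ∧ x ∈ E ∧ χ x = c := by intro x E; simp [hFx]
  have hAcard : ∀ x, #(A x) = #(Fx x) := by
    intro x
    apply card_image_of_injOn
    intro E hE E' hE' h
    have h1 := ((hFxmem x E).1 hE).2.1
    have h2 := ((hFxmem x E').1 hE').2.1
    have h : E.erase x = E'.erase x := h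
    rw [← insert_erase h1, h, insert_erase h2]
  have hAsized : ∀ x, (A x : Set (Finset (Fin n))).Sized (r - 1) := by
    intro x B hB
    obtain ⟨E, hE, rfl⟩ := mem_image.1 (mem_coe.1 hB)
    rw [hFxmem] at hE
    rw [card_erase_of_mem hE.2.1, hF.card_eq E hE.1]
  have hAle : ∀ x, (#(A x) : ℝ) ≤ t ^ (r - 1) := by
    intro x
    refine le_trans ?_ (hdeg x)
    rw [hAcard]
    exact_mod_cast card_le_card (fun E hE => by
      rw [hFxmem] at hE
      exact mem_filter.2 ⟨hE.1, hE.2.1⟩)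
  have hcover : F ⊆ univ.biUnion Fx := by
    intro E hE
    obtain ⟨x, hx, hxc⟩ := exists_mem_color_eq (hF.rainbow E hE) (hF.card_eq E hE) c
    exact mem_biUnion.2 ⟨x, mem_univ _, (hFxmem x E).2 ⟨hE, hx, hxc⟩⟩
  have hsum : #F ≤ ∑ x, #(A x) := by
    simp only [hAcard]
    exact (card_le_card hcover).trans card_biUnion_le
  have hshadow : ∀ x, ∀ D ∈ ∂^[2] (A x), ∃ E ∈ F, x ∈ E ∧ χ x = c ∧
      #D = r - 3 ∧ ∃ P ∈ N, part χ P E = D := by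
    intro x D hD
    obtain ⟨B, hB, hDB, hc⟩ := mem_shadow_iterate_iff_exists_sdiff.1 hD
    have hBc := hAsized x hB
    obtain ⟨E, hE, rfl⟩ := mem_image.1 hB
    rw [hFxmem] at hE
    obtain ⟨hEF, hxE, hxc⟩ := hE
    have hDE : D ⊆ E := hDB.trans (erase_subset _ _)
    have hDc : #D = r - 3 := by
      rw [card_sdiff_of_subset hDB, hBc] at hc
      have := card_le_card hDB
      omega
    have hPc : #(D.image χ) = r - 3 := by
      rw [card_image_of_injOn ((hF.rainbow E hEF).mono hDE), hDc]
    have hcP : c ∉ D.image χ := by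
      intro h
      obtain ⟨v, hv, hvc⟩ := mem_image.1 h
      have := hF.rainbow E hEF (hDE hv) hxE (hvc.trans hxc.symm)
      subst this
      exact (mem_erase.1 (hDB hv)).1 rfl
    have h2 : #(((D.image χ)ᶜ).erase c) = 2 := by
      rw [card_erase_of_mem (by simpa using hcP), card_compl, hPc, Fintype.card_fin]
      omega
    obtain ⟨a, b, hab, h3⟩ := card_eq_two.1 h2
    have ha : a ∈ ((D.image χ)ᶜ).erase c := by rw [h3]; simp
    have hb : b ∈ ((D.image χ)ᶜ).erase c := by rw [h3]; simp
    have hP : D.image χ = ({a, b, c}ᶜ : Finset (Fin r)) := by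
      have h4 : insert c (((D.image χ)ᶜ).erase c) = (D.image χ)ᶜ :=
        insert_erase (by simpa using hcP)
      rw [h3] at h4
      rw [← compl_compl (D.image χ), ← h4]
      congr 1
      ext v
      simp only [mem_insert, mem_singleton]
      tauto
    refine ⟨E, hEF, hxE, hxc, hDc, D.image χ, ?_, ?_⟩
    · rw [hP]
      exact hN' a b hab (mem_erase.1 ha).1 (mem_erase.1 hb).1
    · ext v
      rw [mem_part, mem_image]
      constructor
      · rintro ⟨hv, u, hu, huv⟩
        have := hF.rainbow E hEF (hDE hu) hv huv
        exact this ▸ hu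
      · intro hv
        exact ⟨hDE hv, v, hv, rfl⟩
  have hdisj : ∀ x ∈ (univ : Finset (Fin n)), ∀ y ∈ (univ : Finset (Fin n)), x ≠ y →
      Disjoint (∂^[2] (A x)) (∂^[2] (A y)) := by
    intro x _ y _ hxy
    rw [disjoint_left]
    intro D hDx hDy
    obtain ⟨E, hE, hxE, hxc, -, P, hP, hPE⟩ := hshadow x D hDx
    obtain ⟨E', hE', hyE, hyc, -, P', -, hPE'⟩ := hshadow y D hDy
    have h1 : x ∈ E' := hF.mem_of_part_subset hM hP (hN _ (mem_insert_self _ _)) hE hE'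
      (by rw [hPE, ← hPE']; exact part_subset _ _) hxE hxc
    exact hxy (hF.rainbow E' hE' h1 hyE (hxc.trans hyc.symm))
  have hshsum : ∑ x, #(∂^[2] (A x)) ≤ n ^ (r - 3) := by
    rw [← card_biUnion hdisj]
    refine le_trans ?_ (Nat.choose_le_pow n (r - 3))
    have h1 : univ.biUnion (fun x => ∂^[2] (A x)) ⊆ powersetCard (r - 3) univ := by
      intro D hD
      obtain ⟨x, -, hD⟩ := mem_biUnion.1 hD
      obtain ⟨E, -, -, -, hc, -⟩ := hshadow x D hD
      exact mem_powersetCard.2 ⟨subset_univ _, hc⟩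
    simpa using card_le_card h1
  have hrc : (((r - 1 : ℕ) : ℝ) + 1) = r := by
    have : r - 1 + 1 = r := by omega
    exact_mod_cast this
  calc (#F : ℝ) ≤ ∑ x, (#(A x) : ℝ) := by exact_mod_cast hsum
    _ ≤ ∑ x, (r * (r - 1).factorial) ^ 2 * t ^ 2 * (#(∂^[2] (A x)) : ℝ) := by
      refine sum_le_sum fun x _ => ?_
      have := card_le_mul_card_shadow (by omega) (hAsized x) ht (hAle x)
      rwa [hrc] at this
    _ = (r * (r - 1).factorial) ^ 2 * t ^ 2 * ∑ x, (#(∂^[2] (A x)) : ℝ) := by rw [mul_sum]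
    _ ≤ _ := by
      gcongr
      exact_mod_cast hshsum

/-- If there are no two colours such that all patterns missing both are allowed, the hypotheses of
`Homogeneous.card_le_of_degree_le` on the patterns hold for some colour `c`, unless the family has
at most `n ^ (r - 2)` edges. -/
lemma Homogeneous.card_le_of_not_pair {n r M : ℕ} {χ : Fin n → Fin r}
    {N : Finset (Finset (Fin r))} {F : Finset (Finset (Fin n))} (hF : Homogeneous M χ N F)
    (hM : 2 * r ≤ M) (hr : 3 ≤ r)
    (hno : F.Nonempty → ∀ a b : Fin r, a ≠ b → ¬ ∀ P : Finset (Fin r), a ∉ P → b ∉ P → P ∉ N)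
    {t : ℝ} (ht : 0 ≤ t) (hdeg : ∀ x, (#(F.filter (fun E => x ∈ E)) : ℝ) ≤ t ^ (r - 1)) :
    (#F : ℝ) ≤ (n : ℝ) ^ (r - 2) + (r * (r - 1).factorial) ^ 2 * (t ^ 2 * (n : ℝ) ^ (r - 3)) := by
  have h0 : 0 ≤ ((r : ℝ) * (r - 1).factorial) ^ 2 * (t ^ 2 * (n : ℝ) ^ (r - 3)) := by positivity
  have h0' : 0 ≤ (n : ℝ) ^ (r - 2) := by positivity
  rcases F.eq_empty_or_nonempty with rfl | hne
  · simp only [card_empty, Nat.cast_zero]; linarith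
  rcases hF.trichotomy hne (by omega) hM with h | ⟨a, b, hab, h⟩ | ⟨z, hz⟩
  · have h1 : (#F : ℝ) ≤ (n : ℝ) ^ (r - 2) := by exact_mod_cast h.trans (Nat.choose_le_pow _ _)
    linarith
  · exact absurd h (hno hne a b hab)
  · have h1 := hF.card_le_of_degree_le (by omega) hr hz (by
      intro a b hab haz hbz
      by_contra hN
      refine hno hne a b hab fun P ha hb => ?_
      by_cases hzP : z ∈ P
      · exact hz P hzP
      · have h2 := hF.inter_notMem hne hM hN (hz _ (mem_insert_self z P))
        convert h2 using 2
        ext i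
        simp only [mem_inter, mem_compl, mem_insert, mem_singleton, not_or]
        constructor
        · intro hi
          refine ⟨⟨?_, ?_, ?_⟩, Or.inr hi⟩ <;> rintro rfl <;> contradiction
        · rintro ⟨⟨-, -, h3⟩, rfl | hi⟩
          · exact absurd rfl h3
          · exact hi) ht hdeg
    rw [mul_assoc] at h1
    linarith

end SmallDegree

/-! ### Edges through a set of vertices of large degree -/

section LargeDegree

open Finset

lemma le_add_choose_succ (d s : ℕ) : d ≤ s + d.choose (s + 1) := by
  induction d with
  | zero => omega
  | succ d ih =>
    rw [Nat.choose_succ_succ']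
    rcases Nat.lt_or_ge d s with h | h
    · omega
    · have := Nat.choose_pos h
      omega

/-- If every `s + 1` vertices of `L` have at most `B` common `(r - 1)`-sets in their links, then
most `(r - 1)`-sets are in the links of at most `s` vertices of `L`. -/
lemma card_filter_inter_eq_one_le {n r s B : ℕ} {F : Finset (Finset (Fin n))}
    (hF : (F : Set (Finset (Fin n))).Sized r) (L : Finset (Fin n))
    (hB : ∀ Y ⊆ L, #Y = s + 1 → ∀ D : Finset (Finset (Fin n)),
      (D : Set (Finset (Fin n))).Sized (r - 1) →
      (∀ y ∈ Y, ∀ A ∈ D, y ∉ A ∧ insert y A ∈ F) → #D ≤ B) :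
    #(F.filter (fun E => #(E ∩ L) = 1)) ≤ s * n.choose (r - 1) + #L ^ (s + 1) * B := by
  set 𝒟 := (powersetCard (r - 1) (univ : Finset (Fin n))).filter (fun A => Disjoint A L) with h𝒟
  set d : Finset (Fin n) → Finset (Fin n) := fun A => L.filter (fun x => insert x A ∈ F) with hd
  have hcover : F.filter (fun E => #(E ∩ L) = 1) ⊆
      𝒟.biUnion (fun A => (d A).image (fun x => insert x A)) := by
    intro E hE
    obtain ⟨hEF, hE1⟩ := mem_filter.1 hE
    obtain ⟨x, hx⟩ := card_eq_one.1 hE1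
    have hxE : x ∈ E ∧ x ∈ L := mem_inter.1 (hx ▸ mem_singleton_self x)
    refine mem_biUnion.2 ⟨E.erase x, ?_, mem_image.2 ⟨x, ?_, insert_erase hxE.1⟩⟩
    · refine mem_filter.2 ⟨mem_powersetCard.2 ⟨subset_univ _, ?_⟩, ?_⟩
      · rw [card_erase_of_mem hxE.1, hF hEF]
      · rw [disjoint_left]
        intro v hv hvL
        have h1 : v ∈ E ∩ L := mem_inter.2 ⟨(mem_erase.1 hv).2, hvL⟩
        rw [hx, mem_singleton] at h1
        exact (mem_erase.1 hv).1 h1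
    · refine mem_filter.2 ⟨hxE.2, ?_⟩
      rw [insert_erase hxE.1]
      exact hEF
  have h1 : #(F.filter (fun E => #(E ∩ L) = 1)) ≤ ∑ A ∈ 𝒟, #(d A) :=
    (card_le_card hcover).trans (card_biUnion_le.trans (sum_le_sum fun A _ => card_image_le))
  have h2 : ∑ A ∈ 𝒟, #(d A) ≤ ∑ A ∈ 𝒟, (s + #((d A).powersetCard (s + 1))) := by
    refine sum_le_sum fun A _ => ?_
    rw [card_powersetCard]
    exact le_add_choose_succ _ _
  have h3 : ∑ A ∈ 𝒟, #((d A).powersetCard (s + 1)) =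
      ∑ Y ∈ L.powersetCard (s + 1), #(𝒟.filter (fun A => ∀ y ∈ Y, insert y A ∈ F)) := by
    have h4 : ∀ A, (d A).powersetCard (s + 1) =
        (L.powersetCard (s + 1)).filter (fun Y => ∀ y ∈ Y, insert y A ∈ F) := by
      intro A
      ext Y
      simp only [mem_powersetCard, mem_filter, hd, subset_iff]
      constructor
      · rintro ⟨h, hc⟩
        exact ⟨⟨fun y hy => (h hy).1, hc⟩, fun y hy => (h hy).2⟩
      · rintro ⟨⟨h, hc⟩, h'⟩
        exact ⟨fun y hy => ⟨h hy, h' y hy⟩, hc⟩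
    simp only [h4, card_filter]
    exact sum_comm
  have h5 : ∑ Y ∈ L.powersetCard (s + 1), #(𝒟.filter (fun A => ∀ y ∈ Y, insert y A ∈ F)) ≤
      #L ^ (s + 1) * B := by
    calc _ ≤ ∑ _Y ∈ L.powersetCard (s + 1), B := by
          refine sum_le_sum fun Y hY => ?_
          obtain ⟨hYL, hYc⟩ := mem_powersetCard.1 hY
          refine hB Y hYL hYc _ ?_ ?_
          · intro A hA
            exact (mem_powersetCard.1 (mem_filter.1 (mem_filter.1 hA).1).1).2
          · intro y hy A hA
            obtain ⟨hA1, hA2⟩ := mem_filter.1 hA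
            exact ⟨fun hyA => disjoint_left.1 (mem_filter.1 hA1).2 hyA (hYL hy), hA2 y hy⟩
      _ = (#L).choose (s + 1) * B := by rw [sum_const, card_powersetCard, smul_eq_mul]
      _ ≤ _ := Nat.mul_le_mul_right _ (Nat.choose_le_pow _ _)
  have h6 : #𝒟 ≤ n.choose (r - 1) := by
    refine (card_filter_le _ _).trans ?_
    simp
  rw [sum_add_distrib, sum_const, smul_eq_mul, h3] at h2
  calc _ ≤ _ := h1.trans h2
    _ ≤ n.choose (r - 1) * s + #L ^ (s + 1) * B := Nat.add_le_add (Nat.mul_le_mul_right _ h6) h5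
    _ = _ := by ring

lemma card_filter_two_le_inter {n r : ℕ} {F : Finset (Finset (Fin n))}
    (hF : (F : Set (Finset (Fin n))).Sized r) (L : Finset (Fin n)) :
    #(F.filter (fun E => 2 ≤ #(E ∩ L))) ≤ #L ^ 2 * n ^ (r - 2) := by
  have hcover : F.filter (fun E => 2 ≤ #(E ∩ L)) ⊆
      ((L ×ˢ L) ×ˢ powersetCard (r - 2) (univ : Finset (Fin n))).image
        (fun z => insert z.1.1 (insert z.1.2 z.2)) := by
    intro E hE
    obtain ⟨hEF, hE2⟩ := mem_filter.1 hE
    obtain ⟨x, hx, y, hy, hxy⟩ := one_lt_card.1 hE2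
    rw [mem_inter] at hx hy
    have hy' : y ∈ E.erase x := mem_erase.2 ⟨hxy.symm, hy.1⟩
    refine mem_image.2 ⟨((x, y), (E.erase x).erase y), ?_, ?_⟩
    · simp only [mem_product, mem_powersetCard]
      refine ⟨⟨hx.2, hy.2⟩, subset_univ _, ?_⟩
      rw [card_erase_of_mem hy', card_erase_of_mem hx.1, hF hEF]
      omega
    · simp only [insert_erase hy', insert_erase hx.1]
  refine (card_le_card hcover).trans (card_image_le.trans ?_)
  rw [card_product, card_product, card_powersetCard, card_univ, Fintype.card_fin, sq]
  exact Nat.mul_le_mul_left _ (Nat.choose_le_pow _ _)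

lemma card_mul_le_of_degree {n r : ℕ} {F : Finset (Finset (Fin n))}
    (hF : (F : Set (Finset (Fin n))).Sized r) {L : Finset (Fin n)} {d : ℝ}
    (hL : ∀ x ∈ L, d ≤ (#(F.filter (fun E => x ∈ E)) : ℝ)) : (#L : ℝ) * d ≤ r * #F := by
  have h1 : ∑ x, #(F.filter (fun E => x ∈ E)) = ∑ E ∈ F, #E := by
    simp only [card_filter]
    rw [sum_comm]
    simp
  have h2 : ∑ E ∈ F, #E = #F * r := sum_const_nat fun E hE => hF hE
  calc (#L : ℝ) * d = ∑ _x ∈ L, d := by rw [sum_const, nsmul_eq_mul]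
    _ ≤ ∑ x ∈ L, (#(F.filter (fun E => x ∈ E)) : ℝ) := sum_le_sum hL
    _ ≤ ∑ x, (#(F.filter (fun E => x ∈ E)) : ℝ) :=
      sum_le_sum_of_subset_of_nonneg (subset_univ _) fun _ _ _ => Nat.cast_nonneg _
    _ = r * #F := by
      have h3 := h1.trans h2
      rw [mul_comm (r : ℝ)]
      exact_mod_cast h3

end LargeDegree

/-! ### Upper bounds -/

section Upper

open Finset

variable {V W : Type*} [Fintype V] [DecidableEq V] [Fintype W] [DecidableEq W]

/-- The three error terms of the upper bound, for `β = 1 / ((r - 2) * (s + 2) + 1)` and vertices of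
large degree being those of degree at least `n ^ (r - 1 - γ)` with `γ = (r - 2) * β`. -/
lemma exists_card_le_add_rpow {r m s : ℕ} (hr : 4 ≤ r) {H : Finset (Finset V)}
    (hH : (H : Set (Finset V)).Sized r) {E : ℕ → Finset W} (hE : TreeLike m E)
    (hcard : ∀ i < m, (E i).card = r) {p q : ℕ → W} (hpq : ∀ i < m, p i ≠ q i)
    (hpE : ∀ i < m, p i ∈ E i) (hqE : ∀ i < m, q i ∈ E i)
    (hp : ∀ i < m, ∀ j < m, p i ∈ E j → j = i) (hq : ∀ i < m, ∀ j < m, q i ∈ E j → j = i)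
    {e : V ↪ W} (he : ∀ A ∈ H, ∃ i < m, E i = A.map e) {S : Finset V} (hS : IsCrossCut H S)
    (hSc : #S = s + 1) {β : ℝ} (hβ : β = 1 / (((r : ℝ) - 2) * ((s : ℝ) + 1 + 1) + 1)) :
    ∃ C : ℝ, ∀ n : ℕ, 1 ≤ n → Fintype.card V ≤ n → ∀ F : Finset (Finset (Fin n)),
      (F : Set (Finset (Fin n))).Sized r → ¬ Embeds H F →
      (#F : ℝ) ≤ s * (n.choose (r - 1) : ℝ) + C * (n : ℝ) ^ ((r : ℝ) - 1 - β) := by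
  obtain ⟨C₀, hC₀⟩ := hE.exists_card_le (k := r) (by omega) (fun i hi => (hcard i hi).le)
  obtain ⟨C₁, hC₁⟩ := exists_card_link_le (by omega) hH hE hcard hpE hp he hS
  obtain ⟨c, hc⟩ := exists_homogeneous r (Fintype.card W + 2 * r) (by omega)
  set K : ℝ := (r * (r - 1).factorial) ^ 2 with hK
  refine ⟨c * (1 + K) + (r * C₀) ^ (s + 1) * C₁ + (r * C₀) ^ 2, fun n hn1 hnV F hF hno => ?_⟩
  have hrR : (4 : ℝ) ≤ r := by exact_mod_cast hr
  have hsR : (0 : ℝ) ≤ s := Nat.cast_nonneg s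
  have hden : 0 < ((r : ℝ) - 2) * ((s : ℝ) + 1 + 1) + 1 := by nlinarith
  have hβ0 : 0 < β := by rw [hβ]; positivity
  have hβ1 : β * (((r : ℝ) - 2) * ((s : ℝ) + 1 + 1) + 1) = 1 := by
    rw [hβ]; field_simp
  set γ : ℝ := ((r : ℝ) - 2) * β with hγ
  have hγ0 : 0 ≤ γ := mul_nonneg (by linarith) hβ0.le
  have hγβ : γ * (s + 1) + γ + β = 1 := by rw [hγ]; linarith
  have hsγ : 0 ≤ s * γ := by positivity
  set x : ℝ := (n : ℝ) with hx
  have hx1 : 1 ≤ x := by rw [hx]; exact_mod_cast hn1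
  have hx0 : 0 < x := by linarith
  set u : ℝ := x ^ γ with hu
  set t : ℝ := x ^ (1 - γ / ((r : ℝ) - 1)) with ht
  set R : ℝ := x ^ ((r : ℝ) - 1 - β) with hR
  have hu0 : 0 < u := Real.rpow_pos_of_pos hx0 _
  have ht0 : 0 < t := Real.rpow_pos_of_pos hx0 _
  have hr1 : ((r - 1 : ℕ) : ℝ) = (r : ℝ) - 1 := by rw [Nat.cast_sub (by omega)]; simp
  have hr2 : ((r - 2 : ℕ) : ℝ) = (r : ℝ) - 2 := by rw [Nat.cast_sub (by omega)]; simp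
  have hr3 : ((r - 3 : ℕ) : ℝ) = (r : ℝ) - 3 := by rw [Nat.cast_sub (by omega)]; simp
  have htu : u * t ^ (r - 1) = x ^ (r - 1) := by
    rw [hu, ht, ← Real.rpow_natCast, ← Real.rpow_natCast, ← Real.rpow_mul hx0.le,
      ← Real.rpow_add hx0, hr1]
    congr 1
    have : (r : ℝ) - 1 ≠ 0 := by linarith
    field_simp
    ring
  have hxR : x ^ (r - 2) ≤ R := by
    rw [hR, ← Real.rpow_natCast, hr2]
    exact Real.rpow_le_rpow_of_exponent_le hx1 (by nlinarith)
  have hu2R : u ^ 2 * x ^ (r - 2) ≤ R := by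
    rw [hR, hu, ← Real.rpow_natCast, ← Real.rpow_natCast, ← Real.rpow_mul hx0.le,
      ← Real.rpow_add hx0, hr2]
    refine Real.rpow_le_rpow_of_exponent_le hx1 ?_
    push_cast
    linarith
  have husR : u ^ (s + 1) * x ^ (r - 2) ≤ R := by
    rw [hR, hu, ← Real.rpow_natCast, ← Real.rpow_natCast, ← Real.rpow_mul hx0.le,
      ← Real.rpow_add hx0, hr2]
    refine Real.rpow_le_rpow_of_exponent_le hx1 ?_
    push_cast
    linarith
  have htR : t ^ 2 * x ^ (r - 3) ≤ R := by
    rw [hR, ht, ← Real.rpow_natCast, ← Real.rpow_natCast, ← Real.rpow_mul hx0.le,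
      ← Real.rpow_add hx0, hr3]
    refine Real.rpow_le_rpow_of_exponent_le hx1 ?_
    -- This amounts to `2 * γ / (r - 1) ≥ β`, that is, to `2 * (r - 2) ≥ r - 1`.
    have h1 : β ≤ 2 * (γ / ((r : ℝ) - 1)) := by
      rw [mul_div_assoc', le_div_iff₀ (by linarith), hγ]
      nlinarith
    push_cast
    linarith
  have hnotree : ∀ G ⊆ F, ¬ ∃ f : W → Fin n, Set.InjOn f {w | ∃ i < m, w ∈ E i} ∧
      ∀ i < m, ∃ A ∈ G, (E i).image f ⊆ A := by
    rintro G hGF ⟨f, hf, hfG⟩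
    refine hno (Embeds.of_tree hnV hH (fun A hA => hF hA) he hf fun i hi => ?_)
    obtain ⟨A, hA, hs⟩ := hfG i hi
    exact ⟨A, hGF hA, hs⟩
  have hFle : (#F : ℝ) ≤ C₀ * x ^ (r - 1) := by
    rw [hx]
    exact_mod_cast hC₀ n F hF (hnotree F le_rfl)
  set L : Finset (Fin n) := univ.filter
    (fun v => t ^ (r - 1) ≤ (#(F.filter (fun A => v ∈ A)) : ℝ)) with hL
  have hLc : (#L : ℝ) ≤ r * C₀ * u := by
    have h1 := card_mul_le_of_degree hF (L := L) fun v hv => (mem_filter.1 hv).2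
    have h2 : (#L : ℝ) * t ^ (r - 1) ≤ (r * C₀ * u) * t ^ (r - 1) := by
      calc _ ≤ (r : ℝ) * #F := h1
        _ ≤ r * (C₀ * x ^ (r - 1)) := by gcongr
        _ = _ := by rw [← htu]; ring
    exact le_of_mul_le_mul_right h2 (by positivity)
  have hF2 : (#(F.filter (fun A => 2 ≤ #(A ∩ L))) : ℝ) ≤ (r * C₀) ^ 2 * R := by
    calc (#(F.filter (fun A => 2 ≤ #(A ∩ L))) : ℝ) ≤ (#L : ℝ) ^ 2 * x ^ (r - 2) := by
          rw [hx]
          exact_mod_cast card_filter_two_le_inter hF L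
      _ ≤ (r * C₀ * u) ^ 2 * x ^ (r - 2) := by gcongr
      _ = (r * C₀) ^ 2 * (u ^ 2 * x ^ (r - 2)) := by ring
      _ ≤ _ := by gcongr
  have hF1 : (#(F.filter (fun A => #(A ∩ L) = 1)) : ℝ) ≤
      s * (n.choose (r - 1) : ℝ) + (r * C₀) ^ (s + 1) * C₁ * R := by
    have h1 := card_filter_inter_eq_one_le (s := s) (B := C₁ * n ^ (r - 2)) hF L (by
      intro Y hYL hYc D hD hDF
      have heq : Fintype.card S = Fintype.card Y := by simp [hSc, hYc]
      let b := Fintype.equivOfCardEq heq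
      have hn : Nonempty (Fin n) := ⟨⟨0, hn1⟩⟩
      have hbv : ∀ v (hv : v ∈ S), (if h : v ∈ S then (b ⟨v, h⟩ : Fin n)
          else Classical.arbitrary _) = b ⟨v, hv⟩ := fun v hv => dif_pos hv
      refine hC₁ n hnV F hno (fun v => if h : v ∈ S then (b ⟨v, h⟩ : Fin n)
        else Classical.arbitrary _) ?_ D hD ?_
      · intro v hv w hw hvw
        have hv' : v ∈ S := hv
        have hw' : w ∈ S := hw
        simp only [hbv v hv', hbv w hw'] at hvw
        simpa using b.injective (Subtype.ext hvw)
      · intro v hv A hA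
        simp only [hbv v hv]
        exact hDF _ (b ⟨v, hv⟩).2 A hA)
    calc (#(F.filter (fun A => #(A ∩ L) = 1)) : ℝ) ≤
          s * (n.choose (r - 1) : ℝ) + (#L : ℝ) ^ (s + 1) * (C₁ * x ^ (r - 2)) := by
          rw [hx]
          exact_mod_cast h1
      _ ≤ s * (n.choose (r - 1) : ℝ) + (r * C₀ * u) ^ (s + 1) * (C₁ * x ^ (r - 2)) := by gcongr
      _ = s * (n.choose (r - 1) : ℝ) +
          (r * C₀) ^ (s + 1) * C₁ * (u ^ (s + 1) * x ^ (r - 2)) := by ring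
      _ ≤ _ := by gcongr
  have hF0 : (#(F.filter (fun A => #(A ∩ L) = 0)) : ℝ) ≤ c * (1 + K) * R := by
    obtain ⟨χ, N, G, hGF, hG, hGc⟩ := hc n (F.filter (fun A => #(A ∩ L) = 0))
      (fun A hA => hF (mem_filter.1 hA).1)
    have hGF' : G ⊆ F := hGF.trans (filter_subset _ _)
    have hGle : (#G : ℝ) ≤ (1 + K) * R := by
      have h1 := hG.card_le_of_not_pair (by omega) (by omega) (fun hne a b hab h =>
        hnotree G hGF'
          (hG.exists_embedding_of_pair hne (by omega) hE hcard hpq hpE hqE hp hq hab h))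
        ht0.le (by
          intro v
          by_cases hv : ∃ A ∈ G, v ∈ A
          · obtain ⟨A, hA, hvA⟩ := hv
            have hvL : v ∉ L := by
              intro hvL
              have h2 := card_eq_zero.1 (mem_filter.1 (hGF hA)).2
              have h3 : v ∈ A ∩ L := mem_inter.2 ⟨hvA, hvL⟩
              rw [h2] at h3
              simp at h3
            have h2 : (#(F.filter (fun A => v ∈ A)) : ℝ) ≤ t ^ (r - 1) := by
              by_contra h
              exact hvL (mem_filter.2 ⟨mem_univ _, (not_le.1 h).le⟩)
            refine le_trans ?_ h2
            exact_mod_cast card_le_card (filter_subset_filter _ hGF')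
          · push Not at hv
            rw [filter_false_of_mem hv]
            simp only [card_empty, Nat.cast_zero]
            positivity)
      calc (#G : ℝ) ≤ x ^ (r - 2) + K * (t ^ 2 * x ^ (r - 3)) := h1
        _ ≤ R + K * R := by gcongr
        _ = _ := by ring
    calc (#(F.filter (fun A => #(A ∩ L) = 0)) : ℝ) ≤ c * #G := by exact_mod_cast hGc
      _ ≤ c * ((1 + K) * R) := by gcongr
      _ = _ := by ring
  have hsplit : F ⊆ F.filter (fun A => #(A ∩ L) = 0) ∪ (F.filter (fun A => #(A ∩ L) = 1) ∪
      F.filter (fun A => 2 ≤ #(A ∩ L))) := by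
    intro A hA
    simp only [mem_union, mem_filter, hA, true_and]
    omega
  have hsum : (#F : ℝ) ≤ (#(F.filter (fun A => #(A ∩ L) = 0)) : ℝ) +
      ((#(F.filter (fun A => #(A ∩ L) = 1)) : ℝ) + (#(F.filter (fun A => 2 ≤ #(A ∩ L))) : ℝ)) := by
    have h1 := (card_le_card hsplit).trans ((card_union_le _ _).trans
      (Nat.add_le_add_left (card_union_le _ _) _))
    exact_mod_cast h1
  linarith

/-- If a single vertex of `H` is a cross-cut, then `H` also embeds in the third case of
`Homogeneous.trichotomy`: the edges of the tree through that vertex form a tree again. -/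
lemma exists_card_le_of_crossCut_singleton {r m : ℕ} (hr : 4 ≤ r) {H : Finset (Finset V)}
    (hH : (H : Set (Finset V)).Sized r) {E : ℕ → Finset W} (hE : TreeLike m E)
    (hcard : ∀ i < m, (E i).card = r) {p q : ℕ → W} (hpq : ∀ i < m, p i ≠ q i)
    (hpE : ∀ i < m, p i ∈ E i) (hqE : ∀ i < m, q i ∈ E i)
    (hp : ∀ i < m, ∀ j < m, p i ∈ E j → j = i) (hq : ∀ i < m, ∀ j < m, q i ∈ E j → j = i)
    {e : V ↪ W} (he : ∀ A ∈ H, ∃ i < m, E i = A.map e) {v : V} (hv : ∀ A ∈ H, v ∈ A) :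
    ∃ C : ℝ, ∀ n : ℕ, Fintype.card V ≤ n → ∀ F : Finset (Finset (Fin n)),
      (F : Set (Finset (Fin n))).Sized r → ¬ Embeds H F → (#F : ℝ) ≤ C * (n : ℝ) ^ (r - 2) := by
  obtain ⟨c, hc⟩ := exists_homogeneous r (Fintype.card W + 2 * r) (by omega)
  refine ⟨c, fun n hnV F hF hno => ?_⟩
  obtain ⟨χ, N, G, hGF, hG, hGc⟩ := hc n F hF
  have hGle : #G ≤ n ^ (r - 2) := by
    rcases G.eq_empty_or_nonempty with rfl | hne
    · simp
    have hnotree : ∀ E' : ℕ → Finset W, (∀ A ∈ H, ∃ i < m, E' i = A.map e) →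
        ¬ ∃ f : W → Fin n, Set.InjOn f {w | ∃ i < m, w ∈ E' i} ∧
          ∀ i < m, ∃ A ∈ G, (E' i).image f ⊆ A := by
      rintro E' hE' ⟨f, hf, hfG⟩
      refine hno (Embeds.of_tree hnV hH (fun A hA => hF hA) hE' hf fun i hi => ?_)
      obtain ⟨A, hA, hs⟩ := hfG i hi
      exact ⟨A, hGF hA, hs⟩
    rcases hG.trichotomy hne (by omega) (by omega) with h | ⟨a, b, hab, h⟩ | ⟨z, hz⟩
    · exact h.trans (Nat.choose_le_pow _ _)
    · exact absurd (hG.exists_embedding_of_pair hne (by omega) hE hcard hpq hpE hqE hp hq hab h)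
        (hnotree E he)
    · refine absurd (hG.exists_embedding_of_center (W := W) (v := e v) hne (by omega)
        (hE.star (e v)) ?_ ?_ hz) (hnotree _ ?_)
      · intro i hi
        split_ifs
        · exact (hcard i hi).le
        · rw [card_singleton]; omega
      · intro i _
        split_ifs with h <;> simp [h]
      · intro A hA
        obtain ⟨i, hi, h⟩ := he A hA
        refine ⟨i, hi, ?_⟩
        have h1 : e v ∈ E i := h ▸ mem_map_of_mem e (hv A hA)
        exact (if_pos h1).trans h
  calc (#F : ℝ) ≤ c * #G := by exact_mod_cast hGc
    _ ≤ c * (n : ℝ) ^ (r - 2) := by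
      gcongr
      exact_mod_cast hGle

end Upper

/-! ### The lower bound and the Turán number -/

section Turan

open Finset

variable {V : Type*} {H : Finset (Finset V)}

lemma turanNumber_le {r n : ℕ} (hne : H.Nonempty) {B : ℝ}
    (h : ∀ F : Finset (Finset (Fin n)), (F : Set (Finset (Fin n))).Sized r → ¬ Embeds H F →
      (#F : ℝ) ≤ B) : (turanNumber r n H : ℝ) ≤ B := by
  have hmem := Nat.sSup_mem (s := {k : ℕ | ∃ F : Finset (Finset (Fin n)),
    (F : Set (Finset (Fin n))).Sized r ∧ ¬ Embeds H F ∧ F.card = k}) ⟨0, ∅, by simp [Set.Sized], by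
      rintro ⟨f, hf⟩
      obtain ⟨A, hA⟩ := hne
      exact absurd (hf A hA) (notMem_empty _), rfl⟩ (bddAbove_turan r n H)
  obtain ⟨F, hF, hno, hc⟩ := hmem
  have := h F hF hno
  rw [hc] at this
  exact this

lemma card_le_turanNumber {r n : ℕ} {F : Finset (Finset (Fin n))}
    (hF : (F : Set (Finset (Fin n))).Sized r) (hno : ¬ Embeds H F) : #F ≤ turanNumber r n H :=
  le_csSup (bddAbove_turan r n H) ⟨F, hF, hno, rfl⟩

variable [DecidableEq V]

lemma IsCrossCut.comap {W : Type*} [DecidableEq W] [Fintype V] {G : Finset (Finset W)} {f : V ↪ W}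
    (hf : ∀ A ∈ H, A.map f ∈ G) {S : Finset W} (hS : IsCrossCut G S) :
    IsCrossCut H (univ.filter (fun v => f v ∈ S)) := by
  intro A hA
  rw [← hS _ (hf A hA), ← card_map f]
  congr 1
  ext w
  simp only [mem_map, mem_inter, mem_filter, mem_univ, true_and]
  constructor
  · rintro ⟨v, ⟨hv, hvS⟩, rfl⟩
    exact ⟨⟨v, hv, rfl⟩, hvS⟩
  · rintro ⟨⟨v, hv, rfl⟩, hvS⟩
    exact ⟨v, ⟨hv, hvS⟩, rfl⟩

lemma choose_le_choose_sub_add (n k s : ℕ) :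
    n.choose (k + 1) ≤ (n - s).choose (k + 1) + s * n ^ k := by
  induction s with
  | zero => simp
  | succ s ih =>
    rcases Nat.eq_zero_or_pos (n - s) with h | h
    · have h1 : n - (s + 1) = n - s := by omega
      rw [h1]
      calc _ ≤ _ := ih
        _ ≤ _ := by gcongr; omega
    · obtain ⟨j, hj⟩ := Nat.exists_eq_add_of_le' h
      have h1 : n - (s + 1) = j := by omega
      rw [hj, Nat.choose_succ_succ'] at ih
      rw [h1]
      have h2 : j.choose k ≤ n ^ k :=
        (Nat.choose_le_pow j k).trans (Nat.pow_le_pow_left (by omega) k)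
      rw [add_mul, one_mul]
      omega

/-- The `r`-sets that meet a fixed set of fewer than `σ(H)` vertices in exactly one vertex form an
`H`-free `r`-graph, since an embedding of `H` would give a cross-cut. -/
lemma mul_choose_le_turanNumber_add [Fintype V] {r s : ℕ} (hr : 2 ≤ r)
    (hs : ∀ S : Finset V, IsCrossCut H S → s < #S) (n : ℕ) :
    s * n.choose (r - 1) ≤ turanNumber r n H + s ^ 2 * n ^ (r - 2) := by
  obtain ⟨k, rfl⟩ := Nat.exists_eq_add_of_le' hr
  have hk1 : k + 2 - 1 = k + 1 := rfl
  have hk2 : k + 2 - 2 = k := rfl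
  rw [hk1, hk2]
  rcases Nat.lt_or_ge n s with hns | hns
  · calc s * n.choose (k + 1) ≤ s * n ^ (k + 1) := by gcongr; exact Nat.choose_le_pow _ _
      _ = s * n * n ^ k := by ring
      _ ≤ s * s * n ^ k := by gcongr
      _ = s ^ 2 * n ^ k := by ring
      _ ≤ _ := Nat.le_add_left _ _
  · obtain ⟨L, -, hL⟩ := exists_subset_card_eq (s := (univ : Finset (Fin n))) (n := s)
      (by simpa using hns)
    set F := (powersetCard (k + 2) (univ : Finset (Fin n))).filter (fun E => #(E ∩ L) = 1) with hF
    have hcut : IsCrossCut F L := fun A hA => (mem_filter.1 hA).2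
    have hno : ¬ Embeds H F := by
      rintro ⟨f, hf⟩
      have h1 := hs _ (hcut.comap hf)
      have h2 : #(univ.filter (fun v => f v ∈ L)) ≤ #L := by
        rw [← card_map f]
        refine card_le_card fun w hw => ?_
        obtain ⟨v, hv, rfl⟩ := mem_map.1 hw
        exact (mem_filter.1 hv).2
      omega
    have hle := card_le_turanNumber
      (fun A hA => (mem_powersetCard.1 (mem_filter.1 (mem_coe.1 hA)).1).2) hno
    have hcount : s * (n - s).choose (k + 1) ≤ #F := by
      have h1 : #(L ×ˢ powersetCard (k + 1) Lᶜ) = s * (n - s).choose (k + 1) := by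
        rw [card_product, card_powersetCard, card_compl, hL, Fintype.card_fin]
      have hdisj : ∀ z ∈ L ×ˢ powersetCard (k + 1) Lᶜ, z.1 ∈ L ∧ Disjoint z.2 L ∧ #z.2 = k + 1 := by
        intro z hz
        obtain ⟨h2, h3⟩ := mem_product.1 hz
        obtain ⟨h3, h4⟩ := mem_powersetCard.1 h3
        refine ⟨h2, disjoint_left.2 fun v hv => by simpa using h3 hv, h4⟩
      have hinter : ∀ z ∈ L ×ˢ powersetCard (k + 1) Lᶜ, insert z.1 z.2 ∩ L = {z.1} := by
        intro z hz
        obtain ⟨h2, h3, -⟩ := hdisj z hz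
        rw [insert_inter_of_mem h2, disjoint_iff_inter_eq_empty.1 h3]
        rfl
      have hnot : ∀ z ∈ L ×ˢ powersetCard (k + 1) Lᶜ, z.1 ∉ z.2 := by
        intro z hz h
        obtain ⟨h2, h3, -⟩ := hdisj z hz
        exact disjoint_left.1 h3 h h2
      rw [← h1]
      refine card_le_card_of_injOn (fun z => insert z.1 z.2) ?_ ?_
      · intro z hz
        refine mem_coe.2 (mem_filter.2 ⟨mem_powersetCard.2 ⟨subset_univ _, ?_⟩, ?_⟩)
        · rw [card_insert_of_notMem (hnot z hz), (hdisj z hz).2.2]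
        · rw [hinter z hz, card_singleton]
      · intro z hz z' hz' h
        have h : insert z.1 z.2 = insert z'.1 z'.2 := h
        have h2 : z.1 = z'.1 := by
          have h3 := hinter z hz
          rw [h, hinter z' hz'] at h3
          exact (singleton_injective h3).symm
        refine Prod.ext h2 ?_
        rw [← erase_insert (hnot z hz), h, h2, erase_insert (hnot z' hz')]
    calc s * n.choose (k + 1) ≤ s * ((n - s).choose (k + 1) + s * n ^ k) := by
          gcongr; exact choose_le_choose_sub_add n k s
      _ = s * (n - s).choose (k + 1) + s ^ 2 * n ^ k := by ring
      _ ≤ _ := by gcongr; exact hcount.trans hle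

end Turan

end Hypertree

open Hypertree in
theorem theorem4p1 {V W : Type*} [Fintype V] [DecidableEq V] [Fintype W] [DecidableEq W]
    (r : ℕ) (hr : 4 ≤ r)
    (H : Finset (Finset V)) (hH : (H : Set (Finset V)).Sized r) (hne : H.Nonempty)
    (T : Finset (Finset W)) (hT : (T : Set (Finset W)).Sized r)
    (hTtree : Hypertree.IsTree T) (hTred : Hypertree.IsReducible 2 T)
    (hemb : Hypertree.Embeds H T)
    (σ : ℕ) (hσ : σ = Hypertree.crossCutNumber H)
    (β : ℝ) (hβ : β = 1 / (((r : ℝ) - 2) * ((σ : ℝ) + 1) + 1)) :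
    (∃ S : Finset V, Hypertree.IsCrossCut H S) ∧
    (∃ C : ℝ, ∀ n : ℕ, 1 ≤ n →
      ((σ : ℝ) - 1) * (n.choose (r - 1) : ℝ) - C * (n : ℝ) ^ (r - 2)
        ≤ (Hypertree.turanNumber r n H : ℝ)) ∧
    (∃ C : ℝ, ∀ n : ℕ, 1 ≤ n →
      (Hypertree.turanNumber r n H : ℝ)
        ≤ ((σ : ℝ) - 1) * (n.choose (r - 1) : ℝ) + C * (n : ℝ) ^ ((r : ℝ) - 1 - β)) ∧
    (σ = 1 → ∃ C : ℝ, ∀ n : ℕ, 1 ≤ n →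
      (Hypertree.turanNumber r n H : ℝ) ≤ C * (n : ℝ) ^ (r - 2)) := by
  obtain ⟨m, E, hE, hmem, hinj⟩ := hTtree.exists_treeLike
  have hET : ∀ i < m, E i ∈ T := fun i hi => (hmem _).2 ⟨i, hi, rfl⟩
  have hcard : ∀ i < m, (E i).card = r := fun i hi => hT (hET i hi)
  obtain ⟨e, he⟩ := hemb
  have he' : ∀ A ∈ H, ∃ i < m, E i = A.map e := fun A hA => (hmem _).1 (he A hA)
  have hW : Nonempty W := by
    obtain ⟨A, hA⟩ := hne
    have : 0 < A.card := by rw [hH hA]; omega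
    obtain ⟨v, -⟩ := Finset.card_pos.1 this
    exact ⟨e v⟩
  have hpq : ∀ i, ∃ p q, i < m → p ≠ q ∧ p ∈ E i ∧ q ∈ E i ∧ (∀ j < m, p ∈ E j → j = i) ∧
      ∀ j < m, q ∈ E j → j = i := by
    intro i
    by_cases hi : i < m
    · obtain ⟨p, q, h1, h2, h3, h4, h5⟩ := exists_private_pair hTred (hET i hi)
      exact ⟨p, q, fun _ => ⟨h1, h2, h3, fun j hj h => hinj j hj i hi (h4 _ (hET j hj) h),
        fun j hj h => hinj j hj i hi (h5 _ (hET j hj) h)⟩⟩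
    · exact ⟨Classical.arbitrary W, Classical.arbitrary W, fun h => absurd h hi⟩
  choose p q hpq using hpq
  have hTcut : IsCrossCut T ((Finset.range m).image p) := by
    intro A hA
    obtain ⟨i, hi, rfl⟩ := (hmem A).1 hA
    rw [Finset.card_eq_one]
    refine ⟨p i, ?_⟩
    ext w
    simp only [Finset.mem_inter, Finset.mem_image, Finset.mem_range, Finset.mem_singleton]
    constructor
    · rintro ⟨hw, j, hj, rfl⟩
      rw [(hpq j hj).2.2.2.1 i hi hw]
    · rintro rfl
      exact ⟨(hpq i hi).2.1, i, hi, rfl⟩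
  have hcut : ∃ S : Finset V, IsCrossCut H S := ⟨_, hTcut.comap he⟩
  have hmin : ∃ S : Finset V, IsCrossCut H S ∧ S.card = σ := by
    obtain ⟨S₀, hS₀⟩ := hcut
    have h := Nat.sInf_mem (s := {k : ℕ | ∃ S : Finset V, IsCrossCut H S ∧ S.card = k})
      ⟨_, S₀, hS₀, rfl⟩
    rw [hσ]
    exact h
  have hle : ∀ S : Finset V, IsCrossCut H S → σ ≤ S.card := by
    intro S hS
    rw [hσ]
    exact Nat.sInf_le ⟨S, hS, rfl⟩
  obtain ⟨S, hS, hSc⟩ := hmin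
  have hσ1 : 1 ≤ σ := by
    obtain ⟨A, hA⟩ := hne
    rw [← hSc, ← hS A hA]
    exact Finset.card_le_card Finset.inter_subset_right
  obtain ⟨s, rfl⟩ := Nat.exists_eq_add_of_le' hσ1
  have hs1 : ((s + 1 : ℕ) : ℝ) - 1 = s := by push_cast; ring
  -- For `n < |V|` even the number of all subsets of the vertex set is bounded.
  have hsmall : ∀ n, n < Fintype.card V → ∀ F : Finset (Finset (Fin n)),
      (F.card : ℝ) ≤ 2 ^ Fintype.card V := by
    intro n hn F
    have h1 : F.card ≤ 2 ^ n := by simpa using F.card_le_univ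
    have h2 : 2 ^ n ≤ 2 ^ Fintype.card V := Nat.pow_le_pow_right (by norm_num) hn.le
    exact_mod_cast h1.trans h2
  refine ⟨hcut, ⟨(s : ℝ) ^ 2, fun n _ => ?_⟩, ?_, ?_⟩
  · have h := mul_choose_le_turanNumber_add (H := H) (r := r) (s := s) (by omega)
      (fun S hS => hle S hS) n
    have h' : (s : ℝ) * n.choose (r - 1) ≤ turanNumber r n H + (s : ℝ) ^ 2 * (n : ℝ) ^ (r - 2) := by
      exact_mod_cast h
    rw [hs1]
    linarith
  · obtain ⟨C, hC⟩ := exists_card_le_add_rpow hr hH hE hcard (fun i hi => (hpq i hi).1)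
      (fun i hi => (hpq i hi).2.1) (fun i hi => (hpq i hi).2.2.1)
      (fun i hi => (hpq i hi).2.2.2.1) (fun i hi => (hpq i hi).2.2.2.2) he' hS hSc
      (β := β) (by rw [hβ]; push_cast; rfl)
    have hβle : β ≤ 1 := by
      have hr' : (4 : ℝ) ≤ r := by exact_mod_cast hr
      have hs' : (0 : ℝ) ≤ (s + 1 : ℕ) := Nat.cast_nonneg _
      rw [hβ]
      exact div_le_one_of_le₀ (by nlinarith) (by nlinarith)
    refine ⟨max C (2 ^ Fintype.card V), fun n hn => turanNumber_le hne fun F hF hno => ?_⟩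
    have hn' : (1 : ℝ) ≤ n := by exact_mod_cast hn
    have hpow : (1 : ℝ) ≤ (n : ℝ) ^ ((r : ℝ) - 1 - β) := by
      refine Real.one_le_rpow hn' ?_
      have hr' : (4 : ℝ) ≤ r := by exact_mod_cast hr
      linarith
    rw [hs1]
    rcases Nat.lt_or_ge n (Fintype.card V) with hnV | hnV
    · calc (F.card : ℝ) ≤ 2 ^ Fintype.card V := hsmall n hnV F
        _ ≤ max C (2 ^ Fintype.card V) * (n : ℝ) ^ ((r : ℝ) - 1 - β) := by
          refine (le_max_right C _).trans (le_mul_of_one_le_right ?_ hpow)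
          exact le_trans (by positivity) (le_max_right C _)
        _ ≤ _ := le_add_of_nonneg_left (by positivity)
    · refine (hC n hn hnV F hF hno).trans ?_
      gcongr
      exact le_max_left _ _
  · intro hs
    obtain ⟨v, hv⟩ := Finset.card_eq_one.1 (hSc.trans hs)
    obtain ⟨C, hC⟩ := exists_card_le_of_crossCut_singleton hr hH hE hcard
      (fun i hi => (hpq i hi).1) (fun i hi => (hpq i hi).2.1) (fun i hi => (hpq i hi).2.2.1)
      (fun i hi => (hpq i hi).2.2.2.1) (fun i hi => (hpq i hi).2.2.2.2) he' (v := v) (by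
        intro A hA
        have h1 : (A ∩ S).Nonempty := by
          rw [← Finset.card_pos, hS A hA]; norm_num
        obtain ⟨u, hu⟩ := h1
        rw [hv, Finset.mem_inter, Finset.mem_singleton] at hu
        exact hu.2 ▸ hu.1)
    refine ⟨max C (2 ^ Fintype.card V), fun n hn => turanNumber_le hne fun F hF hno => ?_⟩
    have hpow : (1 : ℝ) ≤ (n : ℝ) ^ (r - 2) := one_le_pow₀ (by exact_mod_cast hn)
    rcases Nat.lt_or_ge n (Fintype.card V) with hnV | hnV
    · refine (hsmall n hnV F).trans ((le_max_right C _).trans (le_mul_of_one_le_right ?_ hpow))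
      exact le_trans (by positivity) (le_max_right C _)
    · refine (hC n hnV F hF hno).trans ?_
      gcongr
      exact le_max_left _ _
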